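/- **Conventions.** A simplicial complex $\mathcal K$ is a downward closed family of non-empty finite sets (simplices); a $k$-simplex has $k+1$ vertices, and $n_k=n_k(\mathcal K)$ is the number of $k$-simplices. With respect to a linear order of the vertices, $\partial_k\sigma=\sum_j(-1)^j\,\sigma\setminus\{v_{i_j}\}$ for $\sigma=\{v_{i_0}<\dots<v_{i_k}\}$, $k\ge 1$, extended linearly to the real chain spaces with orthonormal basis the $k$-simplices, and $\partial_0=0$. Put $L_k^{up}=\partial_{k+1}\partial_{k+1}^T$, $L_k=\partial_{k+1}\partial_{k+1}^T+\partial_k^T\partial_k$, and let $\lambda_{\min}(L_k)$ be the smallest non-zero eigenvalue of $L_k$. A *coloring* $c$ assigns a natural number to every vertex; the *pattern complex* is $\mathcal K_c=\{c(\sigma):\sigma\in\mathcal K\}$. A coloring of a $d$-dimensional complex is *proper* if the endpoints of each edge have different colors and distinct $(d-1)$-simplices have distinct sets of colors. **The complexes $\mathcal B_d^n$.** Let $\sigma=\{v_0<\dots<v_d\}$ and $\sigma_i=\sigma\setminus\{v_i\}$. For $\tau\subseteq\sigma$, the prism $P\tau$ consists of all subsets of the sets $\{(v,0):v\in\tau,\,v\le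 w\}\cup\{(v,1):v\in\tau,\,w\le v\}$, $w\in\tau$. The building block $B_d$, a complex on the vertices $\sigma\times\{0,1\}$, consists, for $i=0,\dots,d$, of all non-empty sets of the form $\varphi$ or $\varphi\cup\{(v_i,1)\}$ with $\varphi\in P\tau$, $\tau\subsetneq\sigma_i$, and of all non-empty subsets of $(\sigma_i\times\{0\})\cup\{(v_i,1)\}$. The complex $\mathcal B_d^n$, on the vertices $\sigma\times\{0,\dots,n\}$, is the union of the full simplex on $\sigma\times\{0\}$ with $n$ copies of $B_d$; in the $m$-th copy ($1\le m\le n$), $(v_i,0)$ is replaced by $(v_i,m)$ and $(v_i,1)$ by $(v_i,m-1)$. **Theorem.** There is an absolute constant $A>0$, and for every $d\ge 1$ there are constants $c_d\ge 1$ and $\kappa_d>0$ depending only on $d$, with $c_d>1$ if $d\ge 2$, such that for every $n\ge 1$ there is a proper coloring of $\mathcal B_d^n$ whose pattern complex $\mathcal C_d^n$ is $d$-dimensional, has $$n_d\ \ge\ \kappa_d\binom{n_0}{d}$$ $d$-simplices, where $n_0=n_0(\mathcal C_d^n)$ and $n_d=n_d(\mathcal C_d^n)$, and has spectral gaps $$\lambda_{\min}(L_{d-1}[\mathcal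 C_d^n])\le \frac{A}{c_d^{\,n_d}},\qquad \lambda_{\min}(L_d[\mathcal C_d^n])\le\frac{A}{c_d^{\,n_d}}$$ (in particular, both Laplacians have a non-zero eigenvalue). Moreover, proper colorings preserve the spectrum of the up Laplacian: for every finite $d$-dimensional simplicial complex $\mathcal K$ with $d\ge 1$ and every proper coloring $c$ of $\mathcal K$, the operators $L_{d-1}^{up}[\mathcal K_c]$ and $L_{d-1}^{up}[\mathcal K]$ have the same eigenvalues with the same multiplicities. -/

import Mathlib

namespace SpectralGap

section Complexes

variable {V : Type*}

/-- The `k`-simplices of `K`: the faces with `k + 1` vertices. -/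
abbrev Simplex (K : PreAbstractSimplicialComplex V) (k : ℕ) : Type _ :=
  {s : Finset V // s ∈ K.faces ∧ s.card = k + 1}

/-- `n_k`, the number of `k`-simplices of `K`. -/
noncomputable def numSimplices (K : PreAbstractSimplicialComplex V) (k : ℕ) : ℕ :=
  Nat.card (Simplex K k)

/-- `K` has dimension `d`: it has a `d`-simplex, and no simplex of larger dimension. -/
def HasDim (K : PreAbstractSimplicialComplex V) (d : ℕ) : Prop :=
  (∃ s ∈ K.faces, s.card = d + 1) ∧ ∀ s ∈ K.faces, s.card ≤ d + 1

instance instFiniteSimplex (K : PreAbstractSimplicialComplex V) [Finite K.faces] (k : ℕ) :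
    Finite (Simplex K k) :=
  Finite.of_injective (fun s : Simplex K k => (⟨s.1, s.2.1⟩ : K.faces))
    (fun _ _ h => Subtype.ext (Subtype.mk.inj h))

noncomputable instance instFintypeSimplex (K : PreAbstractSimplicialComplex V) [Finite K.faces]
    (k : ℕ) : Fintype (Simplex K k) :=
  Fintype.ofFinite _

/-- `c` is a proper coloring of the `d`-dimensional complex `K`: the endpoints of every edge have
different colors, and distinct `(d-1)`-simplices (those with `d` vertices) have different sets of
colors. -/
def IsProperColoring (K : PreAbstractSimplicialComplex V) (d : ℕ) (c : V → ℕ) : Prop :=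
  (∀ e ∈ K.faces, e.card = 2 → ∀ u ∈ e, ∀ v ∈ e, u ≠ v → c u ≠ c v) ∧
    ∀ s ∈ K.faces, ∀ t ∈ K.faces, s.card = d → t.card = d → s ≠ t → s.image c ≠ t.image c

/-- The pattern complex of `K` with respect to `c`: its faces are the color sets of the faces
of `K`. -/
abbrev patternComplex (K : PreAbstractSimplicialComplex V) (c : V → ℕ) :
    PreAbstractSimplicialComplex ℕ :=
  K.map c

instance instFinitePatternComplex (K : PreAbstractSimplicialComplex V) [h : Finite K.faces]
    (c : V → ℕ) : Finite (patternComplex K c).faces :=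
  Set.Finite.image (fun s : Finset V => s.image c) (Set.toFinite K.faces)

end Complexes

section Laplacians

variable {V : Type*} [LinearOrder V]

/-- The matrix of the boundary map `∂_{k+1} : C_{k+1}(K) → C_k(K)` in the bases of simplices. The
vertex `v` has position `#{w ∈ σ | w < v}` in `σ`, and deleting it contributes
`(-1) ^ position` times the face `σ \ {v}`. -/
def boundary (K : PreAbstractSimplicialComplex V) (k : ℕ) :
    Matrix (Simplex K k) (Simplex K (k + 1)) ℝ :=
  Matrix.of fun τ σ =>
    ∑ v ∈ σ.1, if σ.1.erase v = τ.1 then (-1 : ℝ) ^ (σ.1.filter (· < v)).card else 0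

variable (K : PreAbstractSimplicialComplex V) [Finite K.faces]

/-- The up Laplacian `∂_{k+1} ∂_{k+1}ᵀ` on `C_k(K)`. -/
noncomputable def upLaplacian (k : ℕ) : Matrix (Simplex K k) (Simplex K k) ℝ :=
  boundary K k * (boundary K k).transpose

/-- The down Laplacian `∂_kᵀ ∂_k` on `C_k(K)`, where `∂_0 = 0`. -/
noncomputable def downLaplacian : (k : ℕ) → Matrix (Simplex K k) (Simplex K k) ℝ
  | 0 => 0
  | k + 1 => (boundary K k).transpose * boundary K k

/-- The combinatorial Laplacian `L_k`. -/
noncomputable def laplacian (k : ℕ) : Matrix (Simplex K k) (Simplex K k) ℝ :=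
  upLaplacian K k + downLaplacian K k

end Laplacians

/-- `μ` is the smallest non-zero eigenvalue of `M` (in particular, there is a non-zero
eigenvalue). -/
def IsSpectralGap {I : Type*} [Fintype I] [DecidableEq I] (M : Matrix I I ℝ) (μ : ℝ) : Prop :=
  IsLeast {x : ℝ | x ≠ 0 ∧ Module.End.HasEigenvalue (Matrix.toLin' M) x} μ

section Construction

/-- The prism over the simplex `τ`, in `τ × {0, 1}`: the subsets of the simplices
`{(v, 0) | v ∈ τ, v ≤ j} ∪ {(v, 1) | v ∈ τ, j ≤ v}` with `j ∈ τ`. -/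
def prism {ι : Type*} [LinearOrder ι] (τ : Finset ι) : Set (Finset (ι × Fin 2)) :=
  {φ | ∃ j ∈ τ, φ ⊆ τ.filter (· ≤ j) ×ˢ {0} ∪ τ.filter (j ≤ ·) ×ˢ {1}}

/-- The stellar prism over the simplex `ρ`, with `a` in the role of the center of the subdivided
top face: the simplices `φ` and `φ ∪ {a}` for `φ` in the prism over a proper face of `ρ`, and the
faces of `(ρ × {0}) ∪ {a}`. -/
def stellarPrism {ι : Type*} [LinearOrder ι] (ρ : Finset ι) (a : ι × Fin 2) :
    Set (Finset (ι × Fin 2)) :=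
  {s | s.Nonempty ∧
    ((∃ τ, τ ⊂ ρ ∧ ∃ φ ∈ prism τ, s ⊆ insert a φ) ∨ s ⊆ insert a (ρ ×ˢ {0}))}

/-- The building block `B_d`: the union of the stellar prisms over the facets
`{v_0, …, v_d} \ {v_i}` of the `d`-simplex, where the center of the top of the `i`-th stellar prism
is identified with the vertex `(v_i, 1)`. -/
def buildingBlock (d : ℕ) : PreAbstractSimplicialComplex (Fin (d + 1) × Fin 2) where
  faces := {s | ∃ i, s ∈ stellarPrism (Finset.univ.erase i) (i, 1)}
  isRelLowerSet_faces := by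
    rintro s ⟨i, hs, h⟩
    refine ⟨hs, fun t hts ht => ⟨i, ht, ?_⟩⟩
    rcases h with ⟨τ, hτ, φ, hφ, h⟩ | h
    · exact Or.inl ⟨τ, hτ, φ, hφ, hts.trans h⟩
    · exact Or.inr (hts.trans h)

/-- The inclusion of the vertices of the `(m+1)`-st building block: its bottom vertices `(v_i, 0)`
become `(v_i, m + 1)`, its top vertices `(v_i, 1)` become `(v_i, m)`. -/
def blockInclusion (d : ℕ) {n : ℕ} (m : Fin n) (x : Fin (d + 1) × Fin 2) :
    Fin (d + 1) × Fin (n + 1) :=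
  (x.1, if x.2 = 0 then m.succ else m.castSucc)

/-- The complex `𝓑_d^n` on the vertices `{v_0, …, v_d} × {0, …, n}`: the full simplex on
`{v_0, …, v_d} × {0}`, together with `n` copies of `B_d`, the top of each glued to the bottom of the
previous one. -/
def stackedComplex (d n : ℕ) : PreAbstractSimplicialComplex (Fin (d + 1) × Fin (n + 1)) where
  faces := {s | s.Nonempty ∧ s ⊆ Finset.univ ×ˢ {0}} ∪
    ⋃ m : Fin n, ((buildingBlock d).map (blockInclusion d m)).faces
  isRelLowerSet_faces := by
    rintro s (⟨hs, h⟩ | h)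
    · exact ⟨hs, fun t hts ht => Or.inl ⟨ht, hts.trans h⟩⟩
    · obtain ⟨m, hm⟩ := Set.mem_iUnion.1 h
      have := ((buildingBlock d).map (blockInclusion d m)).isRelLowerSet_faces hm
      exact ⟨this.1, fun t hts ht => Or.inr (Set.mem_iUnion.2 ⟨m, this.2 hts ht⟩)⟩

end Construction

end SpectralGap

namespace SpectralGap

/-! ### Simplices of the pattern complex. -/

section Coloring

variable {V : Type*} {K : PreAbstractSimplicialComplex V} {c : V → ℕ} {d e k : ℕ}

/-! Write `B` for the matrix of `∂_d`, so that `L_{d-1}^{up} = B Bᵀ`, and the kernel of `Bᵀ`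
consists of the cocycles. If a chain `z` is orthogonal to all cocycles, then it lies in the span of
the eigenvectors with non-zero eigenvalue. Any cochain `u` with `u ⬝ z ≠ 0` therefore bounds the
least such eigenvalue by `|Bᵀ u|² |z|² / (u ⬝ z)²` (`exists_eigenvalue_mul_transpose_le`).

In the stacked complex, `z` is the boundary of the simplex spanned by the last layer. Crossing a
building block multiplies the value of a cocycle on the boundary of the layer simplex by `-d`
(`sum_faceTerm_bottom_eq`), and this value is zero on layer `0`, which is filled; so `z` is
orthogonal to all cocycles. The cochain `u` is `layerCochain`: a volume form, multiplied by a
further `-d` on each layer. Its coboundary lives on the bottom simplex only, with value `±(d + 1)`,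
whereas `u ⬝ z = (-d)^n (d + 1)`. Since `|z|² = d + 1`, some eigenvalue `μ ≠ 0` satisfies `μ d^(2n)
≤ d + 1`.

A proper coloring is bijective on simplices of dimensions `d - 1` and `d`, and after sign changes by
the permutations that sort the colors it identifies the boundary matrices
(`boundary_patternComplex`). The up Laplacians are thus similar. Non-zero eigenvalues of
`L_{d-1}^{up}` are eigenvalues of both `L_{d-1}` and `L_d`.

It remains to color with `O(n^{1/d})` colors (`eq_of_paletteColor_subset`). Take a prime `p` of
order `n^{1/d}` with `n < p^d`, and encode the layer `m` by the polynomial of degree less than `d`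
over `ZMod p` whose coefficients are the digits of `m`. A vertex shows the value of this polynomial
at one point; the `d` vertices of a `(d-1)`-simplex give `d` distinct points, which determine the
polynomial and hence the layer. As the number of `d`-simplices lies between `n` and a constant times
`n`, bounds in `n` become bounds in `n_d`. -/

theorem IsProperColoring.injOn (hc : IsProperColoring K d c) {s : Finset V} (hs : s ∈ K.faces) :
    Set.InjOn c s := by
  classical
  intro u hu v hv huv
  by_contra hne
  have hsub : ({u, v} : Finset V) ⊆ s := by
    intro x hx
    simp only [Finset.mem_insert, Finset.mem_singleton] at hx
    rcases hx with rfl | rfl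
    · exact hu
    · exact hv
  exact hc.1 {u, v} ((K.isRelLowerSet_faces hs).2 hsub ⟨u, by simp⟩) (Finset.card_pair hne)
    u (by simp) v (by simp) hne huv

theorem IsProperColoring.card_image (hc : IsProperColoring K d c) {s : Finset V}
    (hs : s ∈ K.faces) : (s.image c).card = s.card :=
  Finset.card_image_of_injOn (hc.injOn hs)

theorem image_mem_patternComplex {s : Finset V} (hs : s ∈ K.faces) :
    s.image c ∈ (patternComplex K c).faces :=
  ⟨s, hs, rfl⟩

theorem image_erase_of_injOn [DecidableEq V] {s : Finset V} (h : Set.InjOn c s) {v : V}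
    (hv : v ∈ s) : (s.erase v).image c = (s.image c).erase (c v) := by
  ext x
  simp only [Finset.mem_image, Finset.mem_erase]
  constructor
  · rintro ⟨w, ⟨hwv, hw⟩, rfl⟩
    exact ⟨fun h' => hwv (h hw hv h'), w, hw, rfl⟩
  · rintro ⟨hx, w, hw, rfl⟩
    exact ⟨w, ⟨fun h' => hx (by rw [h']), hw⟩, rfl⟩

/-- A proper coloring maps `k`-simplices to `k`-simplices of the pattern complex. -/
def simplexImage (hc : IsProperColoring K d c) (k : ℕ) (s : Simplex K k) :
    Simplex (patternComplex K c) k :=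
  ⟨s.1.image c, image_mem_patternComplex s.2.1, by rw [hc.card_image s.2.1, s.2.2]⟩

theorem simplexImage_surjective (hc : IsProperColoring K d c) (k : ℕ) :
    Function.Surjective (simplexImage hc k) := by
  rintro ⟨t, ⟨s, hs, rfl⟩, ht⟩
  exact ⟨⟨s, hs, by rw [← hc.card_image hs, ht]⟩, rfl⟩

theorem simplexImage_injective (hc : IsProperColoring K (e + 1) c) :
    Function.Injective (simplexImage hc e) := by
  rintro ⟨s, hs, hs'⟩ ⟨t, ht, ht'⟩ h
  by_contra hne
  exact hc.2 s hs t ht hs' ht' (fun h' => hne (Subtype.ext h')) (congrArg Subtype.val h)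

/-- Properness controls the facets only. Given `x ∈ s`, delete another vertex `v` from `s` and the
vertex of the same color from `t`: the remaining facets have equal color sets, so they coincide, and
`x ∈ t`. -/
theorem simplexImage_injective_succ (hc : IsProperColoring K (e + 1) c) :
    Function.Injective (simplexImage hc (e + 1)) := by
  classical
  rintro ⟨s, hs, hs'⟩ ⟨t, ht, ht'⟩ h
  have h : s.image c = t.image c := congrArg Subtype.val h
  refine Subtype.ext (Finset.eq_of_subset_of_card_le (fun x hx => ?_) (by simp only; omega))
  obtain ⟨v, hv, hvx⟩ := Finset.exists_mem_ne (by omega : 1 < s.card) x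
  have hcv : c v ∈ t.image c := h ▸ Finset.mem_image_of_mem c hv
  obtain ⟨w, hw, hwv⟩ := Finset.mem_image.1 hcv
  have hface : ∀ {r : Finset V} (_ : r ∈ K.faces) (_ : r.card = e + 1 + 1) {y : V} (_ : y ∈ r),
      r.erase y ∈ K.faces ∧ (r.erase y).card = e + 1 := by
    intro r hr hr' y hy
    have hcard : (r.erase y).card = e + 1 := by rw [Finset.card_erase_of_mem hy, hr']; rfl
    exact ⟨(K.isRelLowerSet_faces hr).2 (Finset.erase_subset _ _)
      (Finset.card_pos.1 (by omega)), hcard⟩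
  have key : s.erase v = t.erase w := by
    by_contra hne
    refine hc.2 _ (hface hs hs' hv).1 _ (hface ht ht' hw).1 (hface hs hs' hv).2
      (hface ht ht' hw).2 hne ?_
    rw [image_erase_of_injOn (hc.injOn hs) hv, image_erase_of_injOn (hc.injOn ht) hw, h, hwv]
  exact Finset.mem_of_mem_erase (key ▸ Finset.mem_erase.2 ⟨hvx.symm, hx⟩)

theorem numSimplices_patternComplex (hc : IsProperColoring K (e + 1) c) :
    numSimplices (patternComplex K c) (e + 1) = numSimplices K (e + 1) :=
  (Nat.card_congr (Equiv.ofBijective _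
    ⟨simplexImage_injective_succ hc, simplexImage_surjective hc _⟩)).symm

end Coloring

/-! ### Proper colorings preserve the spectrum of the up Laplacian. -/

section Sign

variable {V : Type*} [LinearOrder V] {K : PreAbstractSimplicialComplex V} {c : V → ℕ} {e : ℕ}

/-- The sign of the permutation that sorts the colors of `s`. -/
def colorSign (c : V → ℕ) (s : Finset V) : ℝ :=
  (-1) ^ ((s ×ˢ s).filter fun p => p.1 < p.2 ∧ c p.2 < c p.1).card

theorem colorSign_mul_self (c : V → ℕ) (s : Finset V) : colorSign c s * colorSign c s = 1 := by
  rw [colorSign, ← pow_add, ← two_mul, pow_mul]; simp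

/-- The inversions lost with `v` are the pairs of `v` with some `w` in which the vertex order and
the color order disagree. Their number has the parity of (position of `v`) + (position of `c v`),
because a `w` below `v` in both orders is counted twice. -/
theorem colorSign_erase {s : Finset V} (h : Set.InjOn c s) {v : V} (hv : v ∈ s) :
    colorSign c s = colorSign c (s.erase v) * ((-1) ^ (s.filter (· < v)).card *
      (-1) ^ ((s.image c).filter (· < c v)).card) := by
  have h1 : ((s.image c).filter (· < c v)).card = (s.filter fun w => c w < c v).card := by
    rw [Finset.filter_image, Finset.card_image_of_injOn]
    exact h.mono fun x hx => (Finset.mem_filter.1 hx).1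
  have h2 : ((s ×ˢ s).filter fun p => p.1 < p.2 ∧ c p.2 < c p.1).card =
      (((s.erase v) ×ˢ (s.erase v)).filter fun p => p.1 < p.2 ∧ c p.2 < c p.1).card +
      ((s.filter fun w => w < v ∧ c v < c w).card + (s.filter fun w => v < w ∧ c w < c v).card) := by
    have e1 : (s.filter fun w => w < v ∧ c v < c w).card =
        ((s.filter fun w => w < v ∧ c v < c w).image fun w => (w, v)).card :=
      (Finset.card_image_of_injective _ fun a b hab => (Prod.mk.inj hab).1).symm
    have e2 : (s.filter fun w => v < w ∧ c w < c v).card =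
        ((s.filter fun w => v < w ∧ c w < c v).image fun w => (v, w)).card :=
      (Finset.card_image_of_injective _ fun a b hab => (Prod.mk.inj hab).2).symm
    rw [e1, e2, ← Finset.card_union_of_disjoint, ← Finset.card_union_of_disjoint]
    · congr 1
      ext ⟨a, b⟩
      simp only [Finset.mem_filter, Finset.mem_product, Finset.mem_union, Finset.mem_erase,
        Finset.mem_image, Prod.mk.injEq]
      grind
    · rw [Finset.disjoint_left]
      rintro ⟨a, b⟩
      simp only [Finset.mem_filter, Finset.mem_product, Finset.mem_union, Finset.mem_erase,
        Finset.mem_image, Prod.mk.injEq]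
      grind
    · rw [Finset.disjoint_left]
      rintro ⟨a, b⟩
      simp only [Finset.mem_filter, Finset.mem_image, Prod.mk.injEq]
      grind
  have h3 : (s.filter (· < v)).card = (s.filter fun w => w < v ∧ c v < c w).card +
      (s.filter fun w => w < v ∧ c w < c v).card := by
    rw [← Finset.card_union_of_disjoint]
    · congr 1
      ext a
      simp only [Finset.mem_filter, Finset.mem_union]
      constructor
      · rintro ⟨ha, hav⟩
        have : c a ≠ c v := fun h' => hav.ne (h ha hv h')
        grind
      · grind
    · rw [Finset.disjoint_left]
      intro a
      simp only [Finset.mem_filter]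
      grind
  have h4 : (s.filter fun w => c w < c v).card = (s.filter fun w => v < w ∧ c w < c v).card +
      (s.filter fun w => w < v ∧ c w < c v).card := by
    rw [← Finset.card_union_of_disjoint]
    · congr 1
      ext a
      simp only [Finset.mem_filter, Finset.mem_union]
      grind
    · rw [Finset.disjoint_left]
      intro a
      simp only [Finset.mem_filter]
      grind
  rw [colorSign, colorSign, h1, h2, h3, h4, ← pow_add, ← pow_add]
  set x := (s.filter fun w => w < v ∧ c w < c v).card
  rw [show ∀ a b i : ℕ, i + ((a + x) + (b + x)) = i + (a + b) + 2 * x by intros; ring,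
    pow_add _ _ (2 * x), pow_mul]
  simp

theorem boundary_patternComplex (hc : IsProperColoring K (e + 1) c) (τ : Simplex K e)
    (σ : Simplex K (e + 1)) :
    boundary (patternComplex K c) e (simplexImage hc e τ) (simplexImage hc (e + 1) σ) =
      colorSign c τ.1 * boundary K e τ σ * colorSign c σ.1 := by
  have hinj := hc.injOn σ.2.1
  simp only [boundary, Matrix.of_apply, simplexImage]
  rw [Finset.sum_image hinj, Finset.mul_sum, Finset.sum_mul]
  refine Finset.sum_congr rfl fun v hv => ?_
  rw [← image_erase_of_injOn hinj hv]
  by_cases h : σ.1.erase v = τ.1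
  · rw [if_pos (by rw [h]), if_pos h, colorSign_erase hinj hv, h]
    have h1 := colorSign_mul_self c τ.1
    have h2 : ((-1 : ℝ) ^ (σ.1.filter (· < v)).card) * (-1) ^ (σ.1.filter (· < v)).card = 1 := by
      rw [← pow_add, ← two_mul, pow_mul]; simp
    linear_combination (-(-1 : ℝ) ^ ((σ.1.image c).filter (· < c v)).card) * h1 -
      (-1 : ℝ) ^ ((σ.1.image c).filter (· < c v)).card *
        (colorSign c τ.1 * colorSign c τ.1) * h2
  · rw [if_neg h, if_neg, mul_zero, zero_mul]
    intro h'
    have hcard : (σ.1.erase v).card = e + 1 := by rw [Finset.card_erase_of_mem hv, σ.2.2]; rfl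
    refine hc.2 _ ((K.isRelLowerSet_faces σ.2.1).2 (Finset.erase_subset _ _)
      (Finset.card_pos.1 (by omega))) _ τ.2.1 hcard τ.2.2 h h'

theorem charpoly_upLaplacian_patternComplex [Finite K.faces] (hc : IsProperColoring K (e + 1) c) :
    (upLaplacian (patternComplex K c) e).charpoly = (upLaplacian K e).charpoly := by
  let Φ : Simplex K e ≃ Simplex (patternComplex K c) e :=
    Equiv.ofBijective _ ⟨simplexImage_injective hc, simplexImage_surjective hc _⟩
  let Ψ : Simplex K (e + 1) ≃ Simplex (patternComplex K c) (e + 1) :=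
    Equiv.ofBijective _ ⟨simplexImage_injective_succ hc, simplexImage_surjective hc _⟩
  let D : Matrix (Simplex K e) (Simplex K e) ℝ := Matrix.diagonal fun τ => colorSign c τ.1
  have hD : D * D = 1 := by
    simp only [D, Matrix.diagonal_mul_diagonal, colorSign_mul_self, Matrix.diagonal_one]
  have key : upLaplacian (patternComplex K c) e =
      Matrix.reindex Φ Φ (D * upLaplacian K e * D) := by
    rw [← (Matrix.reindex Φ Φ).symm_apply_eq]
    ext τ τ'
    simp only [Matrix.reindex_symm, Matrix.reindex_apply, Matrix.submatrix_apply,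
      Equiv.symm_symm, D, Matrix.diagonal_mul, Matrix.mul_diagonal]
    simp only [upLaplacian, Matrix.mul_apply, Matrix.transpose_apply]
    rw [← Ψ.sum_comp, Finset.mul_sum, Finset.sum_mul]
    refine Finset.sum_congr rfl fun σ _ => ?_
    rw [show Φ τ = simplexImage hc e τ from rfl, show Φ τ' = simplexImage hc e τ' from rfl,
      show Ψ σ = simplexImage hc (e + 1) σ from rfl, boundary_patternComplex,
      boundary_patternComplex]
    linear_combination (colorSign c τ.1 * boundary K e τ σ * boundary K e τ' σ *
      colorSign c τ'.1) * colorSign_mul_self c σ.1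
  rw [key, Matrix.charpoly_reindex]
  rw [Matrix.charpoly_mul_comm, ← mul_assoc, hD, one_mul]

end Sign

/-! ### Linear algebra: small eigenvalues of `B Bᵀ`. -/

section Eigenvalues

open Module.End

variable {m n : Type*} [Fintype m] [Fintype n] [DecidableEq m]

/-- Expand in an orthonormal eigenbasis. By `hz`, `z` has no component in the kernel, so
Cauchy–Schwarz for `u ⬝ z` needs only the indices with non-zero eigenvalue, and on these the
quadratic form at `u` is at least the least non-zero eigenvalue times the sum of squared
coordinates. -/
theorem exists_eigenvalue_mul_transpose_le (B : Matrix m n ℝ) (u z : m → ℝ)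
    (hz : ∀ f, B.transpose.mulVec f = 0 → f ⬝ᵥ z = 0) (hp : u ⬝ᵥ z ≠ 0) :
    ∃ μ : ℝ, μ ≠ 0 ∧ HasEigenvalue (Matrix.toLin' (B * B.transpose)) μ ∧
      μ * (u ⬝ᵥ z) ^ 2 ≤ (B.transpose.mulVec u ⬝ᵥ B.transpose.mulVec u) * (z ⬝ᵥ z) := by
  have hA : (B * B.transpose).IsHermitian := by
    simpa [Matrix.conjTranspose_eq_transpose_of_trivial] using
      Matrix.isHermitian_mul_conjTranspose_self B
  set ev := hA.eigenvalues with hev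
  set w : m → m → ℝ := fun i => (hA.eigenvectorBasis i).ofLp with hw
  have hsum : ∀ x y : m → ℝ, ∑ i, (x ⬝ᵥ w i) * (w i ⬝ᵥ y) = x ⬝ᵥ y := by
    intro x y
    have := hA.eigenvectorBasis.sum_inner_mul_inner (WithLp.toLp 2 x) (WithLp.toLp 2 y)
    simpa [EuclideanSpace.inner_eq_star_dotProduct, dotProduct_comm, hw] using this
  have hmul : ∀ i, (B * B.transpose).mulVec (w i) = ev i • w i := fun i =>
    hA.mulVec_eigenvectorBasis i
  have hquad : ∀ x y : m → ℝ, B.transpose.mulVec x ⬝ᵥ B.transpose.mulVec y =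
      x ⬝ᵥ (B * B.transpose).mulVec y := by
    intro x y
    rw [← Matrix.mulVec_mulVec, Matrix.dotProduct_mulVec x B, ← Matrix.mulVec_transpose]
  have hww : ∀ i, w i ⬝ᵥ w i = 1 := by
    intro i
    have := hA.eigenvectorBasis.orthonormal.1 i
    have h2 : inner ℝ (hA.eigenvectorBasis i) (hA.eigenvectorBasis i) = (1 : ℝ) := by
      rw [real_inner_self_eq_norm_sq, this]; norm_num
    rw [EuclideanSpace.inner_eq_star_dotProduct, star_trivial] at h2
    exact h2
  have hevq : ∀ i, ev i = B.transpose.mulVec (w i) ⬝ᵥ B.transpose.mulVec (w i) := by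
    intro i
    rw [hquad, hmul, dotProduct_smul, hww, smul_eq_mul, mul_one]
  have hnonneg : ∀ i, 0 ≤ ev i := by
    intro i
    rw [hevq]
    exact Finset.sum_nonneg fun j _ => mul_self_nonneg _
  have hzero : ∀ i, ev i = 0 → w i ⬝ᵥ z = 0 := by
    intro i hi
    refine hz _ ?_
    rw [hevq] at hi
    exact dotProduct_self_eq_zero.1 hi
  set S := Finset.univ.filter fun i => ev i ≠ 0 with hS
  have hSsum : ∀ x : m → ℝ, ∑ i ∈ S, (x ⬝ᵥ w i) * (w i ⬝ᵥ z) = x ⬝ᵥ z := by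
    intro x
    rw [← hsum x z]
    refine Finset.sum_subset (Finset.subset_univ _) fun i _ hi => ?_
    have : ev i = 0 := by simpa [hS] using hi
    rw [hzero i this, mul_zero]
  have hSne : S.Nonempty := by
    by_contra h
    rw [Finset.not_nonempty_iff_eq_empty] at h
    have := hSsum u
    rw [h, Finset.sum_empty] at this
    exact hp this.symm
  obtain ⟨i₀, hi₀, hmin⟩ := S.exists_min_image ev hSne
  refine ⟨ev i₀, (Finset.mem_filter.1 hi₀).2, ?_, ?_⟩
  · refine hasEigenvalue_of_hasEigenvector (x := w i₀) ⟨?_, ?_⟩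
    · rw [mem_eigenspace_iff, Matrix.toLin'_apply, hmul]
    · intro h
      have := hww i₀
      rw [h] at this
      simp at this
  · have hBu : B.transpose.mulVec u ⬝ᵥ B.transpose.mulVec u = ∑ i, ev i * (w i ⬝ᵥ u) ^ 2 := by
      rw [hquad, ← hsum]
      refine Finset.sum_congr rfl fun i _ => ?_
      rw [← hquad, hquad, Matrix.dotProduct_mulVec, ← Matrix.mulVec_transpose,
        Matrix.transpose_mul, Matrix.transpose_transpose, hmul, smul_dotProduct, smul_eq_mul,
        dotProduct_comm u]
      ring
    have hBu' : ev i₀ * ∑ i ∈ S, (u ⬝ᵥ w i) ^ 2 ≤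
        B.transpose.mulVec u ⬝ᵥ B.transpose.mulVec u := by
      rw [hBu, Finset.mul_sum]
      refine (Finset.sum_le_sum fun i hi => ?_).trans
        (Finset.sum_le_sum_of_subset_of_nonneg (Finset.subset_univ S) fun i _ _ =>
          mul_nonneg (hnonneg i) (sq_nonneg _))
      rw [dotProduct_comm u]
      exact mul_le_mul_of_nonneg_right (hmin i hi) (sq_nonneg _)
    have hzz : ∑ i ∈ S, (w i ⬝ᵥ z) ^ 2 = z ⬝ᵥ z := by
      rw [← hSsum z]
      exact Finset.sum_congr rfl fun i _ => by rw [dotProduct_comm z, sq]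
    have hcs := Finset.sum_mul_sq_le_sq_mul_sq S (fun i => u ⬝ᵥ w i) (fun i => w i ⬝ᵥ z)
    rw [hSsum, hzz] at hcs
    calc ev i₀ * (u ⬝ᵥ z) ^ 2 ≤ ev i₀ * ((∑ i ∈ S, (u ⬝ᵥ w i) ^ 2) * (z ⬝ᵥ z)) :=
          mul_le_mul_of_nonneg_left hcs (hnonneg _)
      _ = (ev i₀ * ∑ i ∈ S, (u ⬝ᵥ w i) ^ 2) * (z ⬝ᵥ z) := by ring
      _ ≤ _ := mul_le_mul_of_nonneg_right hBu'
        (Finset.sum_nonneg fun j _ => mul_self_nonneg _)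

theorem hasEigenvalue_toLin'_iff_of_charpoly_eq [DecidableEq n] {A : Matrix m m ℝ} {B : Matrix n n ℝ}
    (h : A.charpoly = B.charpoly) (μ : ℝ) :
    HasEigenvalue (Matrix.toLin' A) μ ↔ HasEigenvalue (Matrix.toLin' B) μ := by
  rw [hasEigenvalue_iff_isRoot_charpoly, hasEigenvalue_iff_isRoot_charpoly,
    Matrix.charpoly_toLin', Matrix.charpoly_toLin', h]

theorem exists_isSpectralGap_le {M : Matrix m m ℝ} {μ : ℝ} (h0 : μ ≠ 0)
    (h : HasEigenvalue (Matrix.toLin' M) μ) : ∃ ν, IsSpectralGap M ν ∧ ν ≤ μ := by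
  have hfin : {x : ℝ | x ≠ 0 ∧ HasEigenvalue (Matrix.toLin' M) x}.Finite :=
    (Module.End.finite_hasEigenvalue (Matrix.toLin' M)).subset fun x hx => hx.2
  obtain ⟨ν, hν, hle⟩ := hfin.exists_minimalFor id _ ⟨μ, h0, h⟩
  have hleast : IsSpectralGap M ν := ⟨hν, fun x hx => by
    rcases le_total ν x with hx' | hx'
    · exact hx'
    · exact hle hx hx'⟩
  exact ⟨ν, hleast, hleast.2 ⟨h0, h⟩⟩

theorem exists_mulVec_eq_smul {A : Matrix m m ℝ} {μ : ℝ}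
    (h : HasEigenvalue (Matrix.toLin' A) μ) : ∃ v, v ≠ 0 ∧ A.mulVec v = μ • v := by
  obtain ⟨v, hv⟩ := h.exists_hasEigenvector
  exact ⟨v, hv.2, by simpa [mem_eigenspace_iff, Matrix.toLin'_apply] using hv.1⟩

theorem hasEigenvalue_of_mulVec_eq_smul {A : Matrix m m ℝ} {μ : ℝ} {v : m → ℝ} (h0 : v ≠ 0)
    (h : A.mulVec v = μ • v) : HasEigenvalue (Matrix.toLin' A) μ :=
  hasEigenvalue_of_hasEigenvector (x := v) ⟨by
    rw [mem_eigenspace_iff, Matrix.toLin'_apply, h], h0⟩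

/-- If `v` is an eigenvector of `B Bᵀ`, then `Bᵀ v` is one of `Bᵀ B`; it is non-zero because `μ` is.
-/
theorem hasEigenvalue_transpose_mul_self [DecidableEq n] {B : Matrix m n ℝ} {μ : ℝ} (h0 : μ ≠ 0)
    (h : HasEigenvalue (Matrix.toLin' (B * B.transpose)) μ) :
    HasEigenvalue (Matrix.toLin' (B.transpose * B)) μ := by
  obtain ⟨v, hv, hv'⟩ := exists_mulVec_eq_smul h
  refine hasEigenvalue_of_mulVec_eq_smul (v := B.transpose.mulVec v) ?_ ?_
  · intro h'
    rw [← Matrix.mulVec_mulVec, h', Matrix.mulVec_zero] at hv'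
    exact hv (by simpa [h0] using hv'.symm)
  · rw [← Matrix.mulVec_mulVec, Matrix.mulVec_mulVec v B, hv', Matrix.mulVec_smul]

/-- An eigenvector of `B Bᵀ` with `μ ≠ 0` lies in the image of `B`, which `C` kills. -/
theorem hasEigenvalue_add_transpose_mul_self {l : Type*} [Fintype l] {B : Matrix m n ℝ}
    {C : Matrix l m ℝ} (hCB : C * B = 0) {μ : ℝ} (h0 : μ ≠ 0)
    (h : HasEigenvalue (Matrix.toLin' (B * B.transpose)) μ) :
    HasEigenvalue (Matrix.toLin' (B * B.transpose + C.transpose * C)) μ := by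
  obtain ⟨v, hv, hv'⟩ := exists_mulVec_eq_smul h
  refine hasEigenvalue_of_mulVec_eq_smul hv ?_
  have hCv : C.mulVec v = 0 := by
    have : C.mulVec (μ • v) = 0 := by
      rw [← hv', Matrix.mulVec_mulVec, ← Matrix.mul_assoc, hCB, Matrix.zero_mul,
        Matrix.zero_mulVec]
    rw [Matrix.mulVec_smul] at this
    exact (smul_eq_zero.1 this).resolve_left h0
  rw [Matrix.add_mulVec, hv', ← Matrix.mulVec_mulVec, hCv, Matrix.mulVec_zero, add_zero]

end Eigenvalues

/-! ### From the up Laplacian to the full Laplacians. -/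

section Laplacians

open Module.End

variable {V : Type*} [LinearOrder V] {K : PreAbstractSimplicialComplex V} {k : ℕ}

theorem boundary_apply_erase_sum (τ : Simplex K k) (σ : Simplex K (k + 1)) :
    boundary K k τ σ = ∑ v ∈ σ.1,
      if σ.1.erase v = τ.1 then (-1 : ℝ) ^ (σ.1.filter (· < v)).card else 0 := rfl

theorem erase_mem_simplex (σ : Simplex K (k + 1)) {v : V} (hv : v ∈ σ.1) :
    σ.1.erase v ∈ K.faces ∧ (σ.1.erase v).card = k + 1 := by
  have hcard : (σ.1.erase v).card = k + 1 := by rw [Finset.card_erase_of_mem hv, σ.2.2]; rfl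
  exact ⟨(K.isRelLowerSet_faces σ.2.1).2 (Finset.erase_subset _ _)
    (Finset.card_pos.1 (by omega)), hcard⟩

/-- The coboundary of the cochain given by a function `g` on finite sets. -/
theorem sum_mul_boundary [Finite K.faces] (g : Finset V → ℝ) (σ : Simplex K (k + 1)) :
    ∑ τ : Simplex K k, g τ.1 * boundary K k τ σ =
      ∑ v ∈ σ.1, (-1 : ℝ) ^ (σ.1.filter (· < v)).card * g (σ.1.erase v) := by
  simp_rw [boundary_apply_erase_sum, Finset.mul_sum]
  rw [Finset.sum_comm]
  refine Finset.sum_congr rfl fun v hv => ?_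
  rw [Finset.sum_eq_single (⟨σ.1.erase v, erase_mem_simplex σ hv⟩ : Simplex K k)]
  · rw [if_pos rfl, mul_comm]
  · intro τ _ hτ
    rw [if_neg fun h => hτ (Subtype.ext h.symm), mul_zero]
  · simp

/-- Deleting two vertices in the two possible orders gives the same face with opposite signs. -/
theorem boundary_mul_boundary [Finite K.faces] :
    boundary K k * boundary K (k + 1) = 0 := by
  ext τ σ
  rw [Matrix.mul_apply]
  refine (sum_mul_boundary (fun s : Finset V => ∑ v ∈ s,
    if s.erase v = τ.1 then (-1 : ℝ) ^ (s.filter (· < v)).card else 0) σ).trans ?_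
  set T : V × V → ℝ := fun p => (-1 : ℝ) ^ (σ.1.filter (· < p.1)).card *
    if (σ.1.erase p.1).erase p.2 = τ.1 then
      (-1 : ℝ) ^ ((σ.1.erase p.1).filter (· < p.2)).card else 0 with hT
  have h2 : ∑ v ∈ σ.1, (-1 : ℝ) ^ (σ.1.filter (· < v)).card * (∑ w ∈ σ.1.erase v,
      if (σ.1.erase v).erase w = τ.1 then (-1 : ℝ) ^ ((σ.1.erase v).filter (· < w)).card else 0) =
      ∑ p ∈ σ.1.offDiag, T p := by
    simp_rw [Finset.mul_sum]
    rw [Finset.sum_sigma' σ.1 (fun v => σ.1.erase v)]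
    refine Finset.sum_bij' (fun p _ => (p.1, p.2)) (fun p _ => ⟨p.1, p.2⟩) ?_ ?_ ?_ ?_ ?_
    · rintro ⟨v, w⟩ h
      simp only [Finset.mem_sigma, Finset.mem_erase, Finset.mem_offDiag] at h ⊢
      exact ⟨h.1, h.2.2, h.2.1.symm⟩
    · rintro ⟨v, w⟩ h
      simp only [Finset.mem_sigma, Finset.mem_erase, Finset.mem_offDiag] at h ⊢
      exact ⟨h.1, h.2.2.symm, h.2.1⟩
    all_goals intros; rfl
  have hanti : ∀ v ∈ σ.1, ∀ w ∈ σ.1, v < w → T (v, w) + T (w, v) = 0 := by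
    intro v hv w hw hvw
    simp only [hT]
    rw [Finset.erase_right_comm]
    split_ifs
    · have e1 : ((σ.1.erase v).filter (· < w)).card + 1 = (σ.1.filter (· < w)).card := by
        rw [Finset.filter_erase, Finset.card_erase_add_one]
        exact Finset.mem_filter.2 ⟨hv, hvw⟩
      have e2 : (σ.1.erase w).filter (· < v) = σ.1.filter (· < v) := by
        rw [Finset.filter_erase, Finset.erase_eq_of_notMem]
        simp [hvw.le]
      rw [e2, ← e1, pow_succ]
      ring
    · simp
  rw [Matrix.zero_apply, h2]
  refine Finset.sum_involution (fun p _ => p.swap) ?_ ?_ ?_ ?_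
  · rintro ⟨v, w⟩ h
    obtain ⟨hv, hw, hne⟩ := Finset.mem_offDiag.1 h
    rcases lt_or_gt_of_ne hne with h' | h'
    · exact hanti v hv w hw h'
    · rw [add_comm]; exact hanti w hw v hv h'
  · rintro ⟨v, w⟩ h _ h'
    exact (Finset.mem_offDiag.1 h).2.2 (Prod.mk.inj h').2
  · rintro ⟨v, w⟩ h
    obtain ⟨hv, hw, hne⟩ := Finset.mem_offDiag.1 h
    exact Finset.mem_offDiag.2 ⟨hw, hv, hne.symm⟩
  · intros; rfl

theorem hasEigenvalue_laplacian_of_upLaplacian [Finite K.faces] {μ : ℝ} (h0 : μ ≠ 0)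
    (h : HasEigenvalue (Matrix.toLin' (upLaplacian K k)) μ) :
    HasEigenvalue (Matrix.toLin' (laplacian K k)) μ := by
  cases k with
  | zero => rwa [laplacian, downLaplacian, add_zero]
  | succ k => exact hasEigenvalue_add_transpose_mul_self boundary_mul_boundary h0 h

/-- In the top dimension only the down part `Bᵀ B` of the Laplacian remains. -/
theorem hasEigenvalue_laplacian_succ_of_upLaplacian [Finite K.faces] {μ : ℝ}
    (hdim : HasDim K (k + 1)) (h0 : μ ≠ 0)
    (h : HasEigenvalue (Matrix.toLin' (upLaplacian K k)) μ) :
    HasEigenvalue (Matrix.toLin' (laplacian K (k + 1))) μ := by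
  have hempty : IsEmpty (Simplex K (k + 1 + 1)) :=
    ⟨fun s => by have := hdim.2 s.1 s.2.1; have := s.2.2; omega⟩
  have hup : upLaplacian K (k + 1) = 0 := by
    ext τ τ'
    rw [upLaplacian, Matrix.mul_apply]
    exact Fintype.sum_empty _
  rw [laplacian, hup, zero_add]
  exact hasEigenvalue_transpose_mul_self h0 h

end Laplacians

/-! ### Coboundaries of alternating forms on tuples. -/

section Coboundary

open Function

variable {M : Type*} [AddCommGroup M] [Module ℝ M] {d : ℕ}

/-- The `l`-th term of the coboundary of the alternating cochain `F` at the tuple `y`. -/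
def faceTerm (F : M [⋀^Fin d]→ₗ[ℝ] ℝ) (y : Fin (d + 1) → M) (l : Fin (d + 1)) : ℝ :=
  (-1) ^ (l : ℕ) * F (l.removeNth y)

theorem faceTerm_congr (F : M [⋀^Fin d]→ₗ[ℝ] ℝ) {y y' : Fin (d + 1) → M} {l : Fin (d + 1)}
    (h : ∀ v, v ≠ l → y v = y' v) : faceTerm F y l = faceTerm F y' l := by
  have : l.removeNth y = l.removeNth y' := funext fun v => h _ (Fin.succAbove_ne l v)
  rw [faceTerm, faceTerm, this]

theorem faceTerm_add_eq_zero_of_eq (F : M [⋀^Fin d]→ₗ[ℝ] ℝ) {y : Fin (d + 1) → M}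
    {l j : Fin (d + 1)} (hlj : l ≠ j) (h : y l = y j) : faceTerm F y l + faceTerm F y j = 0 := by
  simpa [faceTerm] using F.neg_one_pow_smul_map_removeNth_add_eq_zero_of_eq h hlj

/-- The two faces consist of the same entries, except that one entry has moved from slot `j` to slot
`l`. Both are faces of one tuple with equal entries in these slots, where they cancel. -/
theorem faceTerm_add_eq_zero (F : M [⋀^Fin d]→ₗ[ℝ] ℝ) {y y' : Fin (d + 1) → M}
    {l j : Fin (d + 1)} (hlj : l ≠ j) (h : y j = y' l) (h' : ∀ v, v ≠ l → v ≠ j → y v = y' v) :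
    faceTerm F y l + faceTerm F y' j = 0 := by
  have h1 : faceTerm F y l = faceTerm F (update y l (y' l)) l :=
    faceTerm_congr F fun v hv => by rw [update_of_ne hv]
  have h2 : faceTerm F y' j = faceTerm F (update y l (y' l)) j :=
    faceTerm_congr F fun v hv => by
      by_cases hvl : v = l
      · rw [hvl, update_self]
      · rw [update_of_ne hvl, h' v hvl hv]
  rw [h1, h2]
  exact faceTerm_add_eq_zero_of_eq F hlj (by rw [update_self, update_of_ne hlj.symm, h])

theorem faceTerm_eq_zero_of_eq (F : M [⋀^Fin d]→ₗ[ℝ] ℝ) {y : Fin (d + 1) → M}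
    {l a b : Fin (d + 1)} (hab : a ≠ b) (hla : a ≠ l) (hlb : b ≠ l) (h : y a = y b) :
    faceTerm F y l = 0 := by
  obtain ⟨a, rfl⟩ := Fin.exists_succAbove_eq hla
  obtain ⟨b, rfl⟩ := Fin.exists_succAbove_eq hlb
  rw [faceTerm, F.map_eq_zero_of_eq (l.removeNth y) (i := a) (j := b) h
    (fun h' => hab (by rw [h'])), mul_zero]

end Coboundary

/-! ### A building block multiplies cocycle values by `-d`. -/

section Prism

open Function

variable {M : Type*} [AddCommGroup M] [Module ℝ M] {d : ℕ}

/-- The vertices of the intermediate simplex in the prism: those before `k` are at the bottom, the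
other ones at the top. -/
def prismStage (d k : ℕ) (v : Fin (d + 1)) : Fin (d + 1) × Fin 2 :=
  (v, if v.val < k then 0 else 1)

theorem image_mem_buildingBlock_bottom (i : Fin (d + 1)) :
    Finset.univ.image (update (fun v => ((v, 0) : Fin (d + 1) × Fin 2)) i (i, 1)) ∈
      (buildingBlock d).faces := by
  refine ⟨i, Finset.univ_nonempty.image _, Or.inr fun x hx => ?_⟩
  obtain ⟨v, -, rfl⟩ := Finset.mem_image.1 hx
  by_cases hv : v = i
  · subst hv; simp
  · simp [hv]

/-- The tuple lists the cone vertex `(i, 1)` and a maximal simplex of the prism over the face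
without `i` and `j`; the vacant slot `j` holds the second copy of `k`. -/
theorem image_mem_buildingBlock_prism {i j k : Fin (d + 1)} (hij : i ≠ j) (hik : i ≠ k)
    (hjk : j ≠ k) :
    Finset.univ.image (update (update (prismStage d (k + 1)) i (i, 1)) j (k, 1)) ∈
      (buildingBlock d).faces := by
  refine ⟨i, Finset.univ_nonempty.image _, Or.inl ⟨(Finset.univ.erase i).erase j,
    Finset.erase_ssubset (by simp [hij.symm]), _, ⟨k, by simp [hik.symm, hjk.symm], le_rfl⟩,
    fun x hx => ?_⟩⟩
  obtain ⟨v, -, rfl⟩ := Finset.mem_image.1 hx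
  by_cases hvj : v = j
  · subst hvj; simp [hik.symm, hjk.symm]
  rw [update_of_ne hvj]
  by_cases hvi : v = i
  · subst hvi; simp
  rw [update_of_ne hvi]
  by_cases hvk : v.val < k + 1
  · have : v ≤ k := by rw [Fin.le_def]; omega
    simp [prismStage, hvk, hvi, hvj, this]
  · have : k ≤ v := by rw [Fin.le_def]; omega
    simp [prismStage, hvk, hvi, hvj, this]

/-- Passing through the building block multiplies the value of a cocycle on the boundary of the
simplex by `-d`. -/
theorem sum_faceTerm_bottom_eq (F : M [⋀^Fin d]→ₗ[ℝ] ℝ) (e : Fin (d + 1) × Fin 2 → M)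
    (h : ∀ y : Fin (d + 1) → Fin (d + 1) × Fin 2, Finset.univ.image y ∈ (buildingBlock d).faces →
      ∑ l, faceTerm F (e ∘ y) l = 0) :
    ∑ l, faceTerm F (fun v => e (v, 0)) l = -d * ∑ l, faceTerm F (fun v => e (v, 1)) l := by
  set N : (Fin (d + 1) → Fin (d + 1) × Fin 2) → Fin (d + 1) → ℝ :=
    fun y l => faceTerm F (e ∘ y) l with hN
  have hcongr : ∀ {y y' : Fin (d + 1) → Fin (d + 1) × Fin 2} {l : Fin (d + 1)},
      (∀ v, v ≠ l → y v = y' v) → N y l = N y' l := fun h' =>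
    faceTerm_congr F fun v hv => by simp [h' v hv]
  have hcancel : ∀ {y y' : Fin (d + 1) → Fin (d + 1) × Fin 2} {l j : Fin (d + 1)}, l ≠ j →
      y j = y' l → (∀ v, v ≠ l → v ≠ j → y v = y' v) → N y l + N y' j = 0 := fun h0 h1 h2 =>
    faceTerm_add_eq_zero F h0 (by simp [h1]) fun v hv hv' => by simp [h2 v hv hv']
  -- `E k` interpolates between top (`k = 0`) and bottom (`k = d + 1`): the `j`-th face of the
  -- `k`-th stage with the cone vertex `(i, 1)` in slot `i`, summed over all `i ≠ j`. At the top,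
  -- each face occurs once for every `i ≠ j`, whence the factor `d`.
  set E : ℕ → ℝ := fun k => ∑ j, ∑ i ∈ Finset.univ.erase j,
    N (update (prismStage d k) i (i, 1)) j with hE
  have hE0 : E 0 = d * ∑ l, faceTerm F (fun v => e (v, 1)) l := by
    simp only [hE]
    rw [Finset.mul_sum]
    refine Finset.sum_congr rfl fun j _ => ?_
    have : ∀ i, update (prismStage d 0) i (i, 1) = fun v => (v, 1) := by
      intro i; ext1 v
      by_cases hv : v = i
      · subst hv; simp
      · simp [update_of_ne hv, prismStage]
    simp_rw [this]
    rw [Finset.sum_const, Finset.card_erase_of_mem (Finset.mem_univ _), nsmul_eq_mul]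
    simp [hN, comp_def]
  -- The faces through `(i, 1)` of the simplex over the bottom of the `i`-th stellar prism can be
  -- traded for its base by the cocycle identity.
  have hEd : E (d + 1) = -∑ l, faceTerm F (fun v => e (v, 0)) l := by
    have h0 : prismStage d (d + 1) = fun v => (v, 0) := by
      ext1 v
      simp [prismStage, v.isLt]
    simp only [hE, h0]
    rw [Finset.sum_comm' (t' := Finset.univ) (s' := fun i => Finset.univ.erase i)
      (by simp [eq_comm]), ← Finset.sum_neg_distrib]
    refine Finset.sum_congr rfl fun i _ => ?_
    have h1 := h _ (image_mem_buildingBlock_bottom i)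
    rw [← Finset.add_sum_erase _ _ (Finset.mem_univ i)] at h1
    have h2 : faceTerm F (e ∘ update (fun v => ((v, 0) : Fin (d + 1) × Fin 2)) i (i, 1)) i =
        faceTerm F (fun v => e (v, 0)) i := faceTerm_congr F fun v hv => by simp [update_of_ne hv]
    rw [h2] at h1
    simp only [hN]
    linarith
  have hstep : ∀ k, k < d + 1 → E (k + 1) = E k := by
    intro k hk
    obtain ⟨κ, rfl⟩ : ∃ κ : Fin (d + 1), k = κ := ⟨⟨k, hk⟩, rfl⟩
    set G := prismStage d (κ + 1) with hG
    have hGκ : ∀ v, v ≠ κ → G v = prismStage d κ v := by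
      intro v hv
      have hv' : v.val ≠ κ := fun h' => hv (Fin.ext h')
      have : v.val < κ + 1 ↔ v.val < κ := by omega
      simp [hG, prismStage, this]
    have hκ : prismStage d κ κ = (κ, 1) := by simp [prismStage]
    set y : Fin (d + 1) → Fin (d + 1) → Fin (d + 1) → Fin (d + 1) × Fin 2 :=
      fun i j => update (update G i (i, 1)) j (κ, 1) with hy
    -- The `j`-th face of the prism simplex `y i j` is the term of the new stage, and its `κ`-th
    -- face is minus the term of the old one. The cocycle identity on `y i j` thus expresses the
    -- change by the other faces.
    have hA : ∀ j, ∀ i ∈ Finset.univ.erase j,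
        N (update G i (i, 1)) j - N (update (prismStage d κ) i (i, 1)) j =
          if i ≠ κ ∧ j ≠ κ then -∑ l ∈ (Finset.univ.erase κ).erase j, N (y i j) l else 0 := by
      intro j i hi
      have hij : i ≠ j := Finset.ne_of_mem_erase hi
      split_ifs with hc
      · obtain ⟨hi', hj'⟩ := hc
        have h0 := h _ (image_mem_buildingBlock_prism hij hi' hj')
        have h1 : N (update G i (i, 1)) j = N (y i j) j :=
          hcongr fun v hv => by simp [hy, update_of_ne hv]
        have h2 : N (y i j) κ + N (update (prismStage d κ) i (i, 1)) j = 0 := by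
          refine hcancel hj'.symm ?_ ?_
          · simp [hy, update_of_ne hi'.symm, hκ]
          · intro v hv hv'
            by_cases hvi : v = i
            · subst hvi; simp [hy, update_of_ne hv']
            · simp [hy, update_of_ne hv', update_of_ne hvi, hGκ v hv]
        rw [← Finset.add_sum_erase _ _ (Finset.mem_univ κ),
          ← Finset.add_sum_erase _ _ (Finset.mem_erase.2 ⟨hj', Finset.mem_univ j⟩)] at h0
        change N (y i j) κ + (N (y i j) j + _) = 0 at h0
        change _ = -∑ l ∈ (Finset.univ.erase κ).erase j, faceTerm F (e ∘ y i j) l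
        rw [h1]
        linarith
      -- The two stages differ only in slot `κ`, which is here either overwritten or deleted.
      · rw [sub_eq_zero]
        refine hcongr fun v hv => ?_
        by_cases hvi : v = i
        · subst hvi; simp
        · rw [update_of_ne hvi, update_of_ne hvi]
          refine hGκ v fun hvk => hc ⟨?_, ?_⟩
          · rintro rfl; exact hvi hvk
          · rintro rfl; exact hv hvk
    rw [← sub_eq_zero]
    simp only [hE]
    rw [← Finset.sum_sub_distrib]
    simp_rw [← Finset.sum_sub_distrib]
    rw [Finset.sum_congr rfl fun j _ => Finset.sum_congr rfl (hA j)]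
    set S : Finset (Fin (d + 1) × Fin (d + 1) × Fin (d + 1)) := Finset.univ.filter fun p =>
      p.2.1 ≠ p.1 ∧ (p.2.1 ≠ κ ∧ p.1 ≠ κ) ∧ p.2.2 ≠ p.1 ∧ p.2.2 ≠ κ with hS
    have hB : (∑ j, ∑ i ∈ Finset.univ.erase j,
        if i ≠ κ ∧ j ≠ κ then -∑ l ∈ (Finset.univ.erase κ).erase j, N (y i j) l else 0) =
        -∑ p ∈ S, N (y p.2.1 p.1) p.2.2 := by
      rw [hS, Finset.sum_filter, Fintype.sum_prod_type, ← Finset.sum_neg_distrib]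
      refine Finset.sum_congr rfl fun j _ => ?_
      rw [Fintype.sum_prod_type, ← Finset.sum_neg_distrib]
      rw [← Finset.filter_ne' Finset.univ j, Finset.sum_filter]
      refine Finset.sum_congr rfl fun i _ => ?_
      by_cases hij : i ≠ j
      · by_cases hc : i ≠ κ ∧ j ≠ κ
        · rw [if_pos hij, if_pos hc, neg_inj, ← Finset.sum_filter]
          refine Finset.sum_congr ?_ fun _ _ => rfl
          ext l
          simp [hij, hc.1, hc.2]
        · simp [hc]
      · simp [hij]
    rw [hB, neg_eq_zero]
    -- The remaining faces are the walls between adjacent prism simplices: each occurs twice, with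
    -- `(κ, 1)` in slot `j` and in slot `l`, and with opposite signs.
    refine Finset.sum_involution
      (fun p _ => if p.2.2 = p.2.1 then (p.2.1, p.1, p.1) else (p.2.2, p.2.1, p.1)) ?_ ?_ ?_ ?_
    · rintro ⟨j, i, l⟩ hp
      simp only [hS, Finset.mem_filter, Finset.mem_univ, true_and] at hp
      obtain ⟨hij, ⟨hi, hj⟩, hlj, hl⟩ := hp
      by_cases hli : l = i
      · subst hli
        simp only [if_true]
        refine hcancel hij ?_ ?_
        · simp [hy]
        · intro v hv hv'
          simp [hy, update_of_ne hv, update_of_ne hv']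
      · simp only [if_neg hli]
        refine hcancel hlj ?_ ?_
        · simp [hy]
        · intro v hv hv'
          simp only [hy, update_of_ne hv, update_of_ne hv']
    · rintro ⟨j, i, l⟩ hp _ h'
      simp only [hS, Finset.mem_filter, Finset.mem_univ, true_and] at hp
      obtain ⟨hij, ⟨hi, hj⟩, hlj, hl⟩ := hp
      split_ifs at h' with hli
      · exact hij (Prod.mk.inj h').1
      · exact hlj (Prod.mk.inj h').1
    · rintro ⟨j, i, l⟩ hp
      simp only [hS, Finset.mem_filter, Finset.mem_univ, true_and] at hp ⊢
      obtain ⟨hij, ⟨hi, hj⟩, hlj, hl⟩ := hp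
      split_ifs with hli
      · exact ⟨hij.symm, ⟨hj, hi⟩, hij.symm, hj⟩
      · exact ⟨Ne.symm hli, ⟨hi, hl⟩, hlj.symm, hj⟩
    · rintro ⟨j, i, l⟩ hp
      simp only [hS, Finset.mem_filter, Finset.mem_univ, true_and] at hp
      obtain ⟨hij, ⟨hi, hj⟩, hlj, hl⟩ := hp
      by_cases hli : l = i
      · subst hli; simp
      · simp [hli, hij.symm]
  have hconst : ∀ k, k ≤ d + 1 → E k = E 0 := by
    intro k
    induction k with
    | zero => intro _; rfl
    | succ k ih => intro hk; rw [hstep k hk, ih (by omega)]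
  have := hconst (d + 1) le_rfl
  rw [hEd, hE0] at this
  linarith

end Prism

/-! ### Simplicial cochains as alternating forms. -/

section Cochains

open Function

variable {V : Type*} [LinearOrder V]

/-- The basis vector of a vertex. -/
def vertexVec (v : V) : V → ℝ := Pi.single v 1

theorem vertexVec_self (v : V) : vertexVec v v = 1 := Pi.single_eq_same v 1

theorem vertexVec_of_ne {v w : V} (h : w ≠ v) : vertexVec v w = 0 := Pi.single_eq_of_ne h 1

/-- The alternating form that is dual to the simplex `s` with its increasing orientation. -/
noncomputable def minor {d : ℕ} (s : Finset V) (h : s.card = d) : (V → ℝ) [⋀^Fin d]→ₗ[ℝ] ℝ :=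
  (Matrix.detRowAlternating (R := ℝ) (n := Fin d)).compLinearMap
    (LinearMap.funLeft ℝ ℝ (s.orderEmbOfFin h))

theorem minor_self {d : ℕ} {s : Finset V} (h : s.card = d) :
    minor s h (fun i => vertexVec (s.orderEmbOfFin h i)) = 1 := by
  have : (fun i => LinearMap.funLeft ℝ ℝ (s.orderEmbOfFin h) (vertexVec (s.orderEmbOfFin h i))) =
      (1 : Matrix (Fin d) (Fin d) ℝ) := by
    ext i j
    rw [LinearMap.funLeft_apply]
    by_cases hij : i = j
    · subst hij; rw [vertexVec_self, Matrix.one_apply_eq]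
    · rw [Matrix.one_apply_ne hij, vertexVec_of_ne]
      exact fun h' => hij ((s.orderEmbOfFin h).injective h').symm
  change Matrix.det _ = 1
  rw [this, Matrix.det_one]

theorem minor_of_ne {d : ℕ} {s t : Finset V} (h : s.card = d) (ht : t.card = d) (hst : s ≠ t) :
    minor s h (fun i => vertexVec (t.orderEmbOfFin ht i)) = 0 := by
  obtain ⟨x, hxt, hxs⟩ : ∃ x ∈ t, x ∉ s := by
    by_contra! hcon
    exact hst (Finset.eq_of_subset_of_card_le hcon (by omega)).symm
  obtain ⟨i, rfl⟩ : x ∈ Set.range (t.orderEmbOfFin ht) := by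
    rw [Finset.range_orderEmbOfFin]; exact hxt
  change Matrix.det _ = 0
  refine Matrix.det_eq_zero_of_row_eq_zero i fun j => ?_
  change vertexVec _ _ = 0
  exact vertexVec_of_ne fun h' => hxs (h' ▸ Finset.orderEmbOfFin_mem s h j)

/-- The sum over the vertices of a simplex, in increasing order. -/
theorem sum_neg_one_pow_card_filter {k : ℕ} (g : V → ℝ) {s : Finset V} (h : s.card = k) :
    ∑ v ∈ s, (-1 : ℝ) ^ (s.filter (· < v)).card * g v =
      ∑ l : Fin k, (-1 : ℝ) ^ (l : ℕ) * g (s.orderEmbOfFin h l) := by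
  have hpos : ∀ l, (s.filter (· < s.orderEmbOfFin h l)).card = l := by
    intro l
    have : s.filter (· < s.orderEmbOfFin h l) =
        (Finset.Iio l).map (s.orderEmbOfFin h).toEmbedding := by
      ext v
      simp only [Finset.mem_filter, Finset.mem_map, Finset.mem_Iio]
      constructor
      · rintro ⟨hv, hlt⟩
        obtain ⟨i, rfl⟩ : v ∈ Set.range (s.orderEmbOfFin h) := by
          rw [Finset.range_orderEmbOfFin]; exact hv
        exact ⟨i, (s.orderEmbOfFin h).lt_iff_lt.1 hlt, rfl⟩
      · rintro ⟨i, hi, rfl⟩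
        exact ⟨Finset.orderEmbOfFin_mem s h i, (s.orderEmbOfFin h).lt_iff_lt.2 hi⟩
    rw [this, Finset.card_map, Fin.card_Iio]
  conv_lhs => rw [← Finset.map_orderEmbOfFin_univ s h]
  rw [Finset.sum_map]
  refine Finset.sum_congr rfl fun l _ => ?_
  simp only [Finset.map_orderEmbOfFin_univ]
  rw [show ((s.orderEmbOfFin h).toEmbedding l) = s.orderEmbOfFin h l from rfl, hpos]

theorem alternatingMap_sum_apply {ι M : Type*} [AddCommGroup M] [Module ℝ M] {d : ℕ}
    (s : Finset ι) (F : ι → M [⋀^Fin d]→ₗ[ℝ] ℝ) (x : Fin d → M) :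
    (∑ i ∈ s, F i) x = ∑ i ∈ s, F i x := by
  classical
  induction s using Finset.induction_on with
  | empty => simp
  | insert a s ha ih => rw [Finset.sum_insert ha, Finset.sum_insert ha, AlternatingMap.add_apply, ih]

variable [Fintype V]

/-- The alternating form that extends the cochain `g`. -/
noncomputable def cochainForm (d : ℕ) (g : Finset V → ℝ) : (V → ℝ) [⋀^Fin d]→ₗ[ℝ] ℝ :=
  ∑ s : {s : Finset V // s.card = d}, g s.1 • minor s.1 s.2

theorem cochainForm_apply_orderEmb {d : ℕ} (g : Finset V → ℝ) {t : Finset V} (ht : t.card = d) :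
    cochainForm d g (fun i => vertexVec (t.orderEmbOfFin ht i)) = g t := by
  rw [cochainForm, alternatingMap_sum_apply, Finset.sum_eq_single ⟨t, ht⟩]
  · rw [AlternatingMap.smul_apply, minor_self, smul_eq_mul, mul_one]
  · intro s _ hs
    rw [AlternatingMap.smul_apply, minor_of_ne s.2 ht fun h => hs (Subtype.ext h), smul_zero]
  · simp

theorem cochainForm_apply_strictMono {d : ℕ} (g : Finset V → ℝ) {y : Fin d → V}
    (hy : StrictMono y) {t : Finset V} (ht : ∀ v, v ∈ t ↔ ∃ j, y j = v) :
    cochainForm d g (fun i => vertexVec (y i)) = g t := by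
  have hcard : t.card = d := by
    have : t = Finset.univ.map ⟨y, hy.injective⟩ := by ext v; simp [ht]
    rw [this, Finset.card_map, Finset.card_univ, Fintype.card_fin]
  have := Finset.orderEmbOfFin_unique hcard (fun i => (ht _).2 ⟨i, rfl⟩) hy
  rw [this, cochainForm_apply_orderEmb]

theorem sum_faceTerm_cochainForm {d : ℕ} (g : Finset V → ℝ) {y : Fin (d + 1) → V}
    (hy : StrictMono y) {t : Fin (d + 1) → Finset V}
    (ht : ∀ l v, v ∈ t l ↔ ∃ j, j ≠ l ∧ y j = v) :
    ∑ l, faceTerm (cochainForm d g) (fun i => vertexVec (y i)) l =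
      ∑ l : Fin (d + 1), (-1) ^ (l : ℕ) * g (t l) := by
  refine Finset.sum_congr rfl fun l _ => ?_
  rw [faceTerm]
  congr 1
  refine cochainForm_apply_strictMono g (y := fun i => y (l.succAbove i))
    (hy.comp (Fin.strictMono_succAbove l)) fun v => ?_
  rw [ht]
  constructor
  · rintro ⟨j, hj, rfl⟩
    obtain ⟨i, rfl⟩ := Fin.exists_succAbove_eq hj
    exact ⟨i, rfl⟩
  · rintro ⟨i, rfl⟩
    exact ⟨_, Fin.succAbove_ne l i, rfl⟩

/-- The sum of the face terms, as an alternating form. -/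
noncomputable def coboundaryForm {d : ℕ} (F : (V → ℝ) [⋀^Fin d]→ₗ[ℝ] ℝ) :
    (V → ℝ) [⋀^Fin (d + 1)]→ₗ[ℝ] ℝ :=
  -- The sum of the coordinates is `1` on every vertex vector, so alternating its product with `F`
  -- gives exactly the face terms there.
  AlternatingMap.alternatizeUncurryFin
    ((∑ v : V, LinearMap.proj v : (V → ℝ) →ₗ[ℝ] ℝ).smulRight F)

theorem coboundaryForm_apply {d : ℕ} (F : (V → ℝ) [⋀^Fin d]→ₗ[ℝ] ℝ) (y : Fin (d + 1) → V) :
    coboundaryForm F (fun i => vertexVec (y i)) =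
      ∑ l, faceTerm F (fun i => vertexVec (y i)) l := by
  rw [coboundaryForm, AlternatingMap.alternatizeUncurryFin_apply]
  refine Finset.sum_congr rfl fun l _ => ?_
  have : ∑ x, vertexVec (y l) x = 1 := by
    rw [Finset.sum_eq_single (y l) (fun x _ hx => vertexVec_of_ne hx) (by simp), vertexVec_self]
  simp [faceTerm, this]

theorem coboundary_eq_sum_faceTerm {d : ℕ} (g : Finset V → ℝ) {s : Finset V}
    (h : s.card = d + 1) :
    ∑ v ∈ s, (-1 : ℝ) ^ (s.filter (· < v)).card * g (s.erase v) =
      ∑ l, faceTerm (cochainForm d g) (fun i => vertexVec (s.orderEmbOfFin h i)) l := by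
  rw [sum_neg_one_pow_card_filter (fun v => g (s.erase v)) h,
    sum_faceTerm_cochainForm g (s.orderEmbOfFin h).strictMono
      (t := fun l => s.erase (s.orderEmbOfFin h l))]
  intro l v
  rw [Finset.mem_erase]
  constructor
  · rintro ⟨hv, hvs⟩
    obtain ⟨i, rfl⟩ : v ∈ Set.range (s.orderEmbOfFin h) := by
      rw [Finset.range_orderEmbOfFin]; exact hvs
    exact ⟨i, fun hi => hv (by rw [hi]), rfl⟩
  · rintro ⟨j, hj, rfl⟩
    exact ⟨fun h' => hj ((s.orderEmbOfFin h).injective h'), Finset.orderEmbOfFin_mem s h j⟩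

/-- A simplicial cocycle satisfies the cocycle identity on all tuples of vertices of simplices. -/
theorem sum_faceTerm_eq_zero_of_cocycle {K : PreAbstractSimplicialComplex V} {d : ℕ}
    (g : Finset V → ℝ) (hg : ∀ s ∈ K.faces, s.card = d + 1 →
      ∑ v ∈ s, (-1 : ℝ) ^ (s.filter (· < v)).card * g (s.erase v) = 0)
    {y : Fin (d + 1) → V} {s : Finset V} (hs : s ∈ K.faces) (hy : ∀ v, v ∈ s ↔ ∃ j, y j = v) :
    ∑ l, faceTerm (cochainForm d g) (fun i => vertexVec (y i)) l = 0 := by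
  -- As an alternating form, the coboundary only changes sign when an injective tuple is sorted, and
  -- it vanishes on tuples with repetitions.
  rw [← coboundaryForm_apply]
  by_cases hinj : Injective y
  · have hcard : s.card = d + 1 := by
      have : s = Finset.univ.map ⟨y, hinj⟩ := by ext v; simp [hy]
      rw [this, Finset.card_map, Finset.card_univ, Fintype.card_fin]
    have hz := hg s hs hcard
    rw [coboundary_eq_sum_faceTerm g hcard, ← coboundaryForm_apply] at hz
    have hex : ∀ i, ∃ j, s.orderEmbOfFin hcard j = y i := by
      intro i
      have : y i ∈ Set.range (s.orderEmbOfFin hcard) := by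
        rw [Finset.range_orderEmbOfFin]; exact (hy _).2 ⟨i, rfl⟩
      exact this
    choose p hp using hex
    have hpinj : Injective p := fun a b hab => hinj (by rw [← hp a, ← hp b, hab])
    have hyp : (fun i => vertexVec (y i)) = (fun i => vertexVec (s.orderEmbOfFin hcard i)) ∘
        Equiv.ofBijective p (Finite.injective_iff_bijective.1 hpinj) := by
      ext1 i
      simp [hp]
    rw [hyp, AlternatingMap.map_perm, hz, smul_zero]
  · refine AlternatingMap.map_eq_zero_of_not_injective _ _ fun h => hinj fun a b hab => h ?_
    simp only [hab]

end Cochains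

/-! ### Faces of the stacked complex. -/

section Stacked

open Function

variable {d n : ℕ}

theorem mem_stackedComplex_of_block (m : Fin n) {t : Finset (Fin (d + 1) × Fin 2)}
    (ht : t ∈ (buildingBlock d).faces) {s : Finset (Fin (d + 1) × Fin (n + 1))}
    (hs : ∀ v, v ∈ s ↔ ∃ x ∈ t, blockInclusion d m x = v) : s ∈ (stackedComplex d n).faces := by
  refine Or.inr (Set.mem_iUnion.2 ⟨m, t, ht, ?_⟩)
  ext v
  simp [hs]

theorem blockInclusion_injective (m : Fin n) : Injective (blockInclusion d m) := by
  rintro ⟨a, b⟩ ⟨a', b'⟩ h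
  obtain ⟨h1, h2⟩ := Prod.mk.inj h
  have h1 : a = a' := h1
  have hm : m.succ ≠ m.castSucc := (Fin.castSucc_lt_succ).ne'
  have : b = b' := by
    fin_cases b <;> fin_cases b' <;> simp_all
  rw [h1, this]

theorem exists_of_mem_stackedComplex {s : Finset (Fin (d + 1) × Fin (n + 1))}
    (hs : s ∈ (stackedComplex d n).faces) :
    s ⊆ Finset.univ ×ˢ {0} ∨ ∃ m : Fin n, ∃ t ∈ (buildingBlock d).faces,
      t.card = s.card ∧ ∀ v, v ∈ s ↔ ∃ x ∈ t, blockInclusion d m x = v := by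
  rcases hs with ⟨-, h⟩ | h
  · exact Or.inl h
  · obtain ⟨m, t, ht, rfl⟩ := Set.mem_iUnion.1 h
    exact Or.inr ⟨m, t, ht, (Finset.card_image_of_injective _ (blockInclusion_injective m)).symm,
      fun v => by simp⟩

/-- The faces of the building block with `d + 1` vertices. -/
theorem buildingBlock_top_cases {t : Finset (Fin (d + 1) × Fin 2)}
    (ht : t ∈ (buildingBlock d).faces) :
    t.card ≤ d + 1 ∧ (t.card = d + 1 → ∃ i,
      t = insert (i, 1) (Finset.univ.erase i ×ˢ {0}) ∨
      ∃ w, w ≠ i ∧ (i, 1) ∈ t ∧ (w, 0) ∈ t ∧ (w, 1) ∈ t) := by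
  obtain ⟨i, -, ⟨τ, hτ, φ, ⟨j, hj, hφ⟩, h⟩ | h⟩ := ht
  -- The two halves of `B` lie over sets that meet only in `j`, so `B` has at most `τ.card + 1 ≤ d`
  -- vertices. A `t` with `d + 1` vertices must consist of `(i, 1)` and all of `B`, including both
  -- copies of `j`.
  · set B := τ.filter (· ≤ j) ×ˢ ({0} : Finset (Fin 2)) ∪ τ.filter (j ≤ ·) ×ˢ {1} with hB
    have hcardτ : τ.card + 1 ≤ d := by
      have h1 := Finset.card_lt_card hτ
      rw [Finset.card_erase_of_mem (Finset.mem_univ i), Finset.card_univ, Fintype.card_fin] at h1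
      omega
    have hBcard : B.card ≤ τ.card + 1 := by
      refine (Finset.card_union_le _ _).trans ?_
      rw [Finset.card_product, Finset.card_product, Finset.card_singleton, Finset.card_singleton,
        mul_one, mul_one, ← Finset.card_union_add_card_inter]
      refine add_le_add (Finset.card_le_card fun x hx => ?_) ?_
      · simp only [Finset.mem_union, Finset.mem_filter] at hx
        exact hx.elim And.left And.left
      · refine (Finset.card_le_card (t := {j}) fun x hx => ?_).trans (Finset.card_singleton j).le
        simp only [Finset.mem_inter, Finset.mem_filter] at hx
        exact Finset.mem_singleton.2 (le_antisymm hx.1.2 hx.2.2)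
    have hsub : t.erase (i, 1) ⊆ B := fun x hx =>
      hφ (((Finset.mem_insert.1 (h (Finset.mem_of_mem_erase hx))).resolve_left
        (Finset.ne_of_mem_erase hx)))
    have hcard := Finset.card_le_card hsub
    have hpred := Finset.pred_card_le_card_erase (s := t) (a := (i, 1))
    refine ⟨by omega, fun htc => ⟨i, Or.inr ⟨j, ?_, ?_, ?_, ?_⟩⟩⟩
    · rintro rfl
      exact absurd (hτ.1 hj) (Finset.notMem_erase _ _)
    · by_contra hmem
      rw [Finset.erase_eq_of_notMem hmem] at hcard
      omega
    all_goals
      refine Finset.mem_of_mem_erase (a := (i, 1)) ?_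
      rw [Finset.eq_of_subset_of_card_le hsub (by omega)]
      simp [hB, hj]
  · have hcard : (insert ((i, 1) : Fin (d + 1) × Fin 2)
        (Finset.univ.erase i ×ˢ ({0} : Finset (Fin 2)))).card = d + 1 := by
      rw [Finset.card_insert_of_notMem (by simp), Finset.card_product, Finset.card_singleton,
        Finset.card_erase_of_mem (Finset.mem_univ i), Finset.card_univ, Fintype.card_fin]
      simp
    exact ⟨(Finset.card_le_card h).trans hcard.le, fun htc =>
      ⟨i, Or.inl (Finset.eq_of_subset_of_card_le h (by omega))⟩⟩

theorem card_le_of_mem_stackedComplex {s : Finset (Fin (d + 1) × Fin (n + 1))}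
    (hs : s ∈ (stackedComplex d n).faces) : s.card ≤ d + 1 := by
  rcases exists_of_mem_stackedComplex hs with h | ⟨m, t, ht, hts, -⟩
  · simpa using Finset.card_le_card h
  · exact hts ▸ (buildingBlock_top_cases ht).1

theorem stackedComplex_top_cases {s : Finset (Fin (d + 1) × Fin (n + 1))}
    (hs : s ∈ (stackedComplex d n).faces) (hcard : s.card = d + 1) :
    s = Finset.univ ×ˢ {0} ∨ ∃ (m : Fin n) (i : Fin (d + 1)),
      (∀ v, v ∈ s ↔ v = (i, m.castSucc) ∨ v.1 ≠ i ∧ v.2 = m.succ) ∨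
      (∃ w, w ≠ i ∧ (i, m.castSucc) ∈ s ∧ (w, m.castSucc) ∈ s ∧ (w, m.succ) ∈ s) ∧
        ∀ v ∈ s, m.val ≤ v.2.val := by
  rcases exists_of_mem_stackedComplex hs with h | ⟨m, t, ht, hts, hmem⟩
  · exact Or.inl (Finset.eq_of_subset_of_card_le h (by simp [hcard]))
  · obtain ⟨i, h | ⟨w, hwi, h1, h2, h3⟩⟩ := (buildingBlock_top_cases ht).2 (by omega)
    · refine Or.inr ⟨m, i, Or.inl fun v => ?_⟩
      rw [hmem, h]
      constructor
      · rintro ⟨⟨a, b⟩, hx, rfl⟩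
        simp only [Finset.mem_insert, Prod.mk.injEq, Finset.mem_product, Finset.mem_erase,
          Finset.mem_univ, and_true, Finset.mem_singleton] at hx
        rcases hx with ⟨rfl, rfl⟩ | ⟨ha, rfl⟩
        · exact Or.inl (by simp [blockInclusion])
        · exact Or.inr ⟨ha, by simp [blockInclusion]⟩
      · rintro (rfl | ⟨h1, h2⟩)
        · exact ⟨(i, 1), by simp, by simp [blockInclusion]⟩
        · exact ⟨(v.1, 0), by simp [h1], by ext <;> simp [blockInclusion, h2]⟩
    · refine Or.inr ⟨m, i, Or.inr ⟨⟨w, hwi, (hmem _).2 ⟨_, h1, by simp [blockInclusion]⟩,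
        (hmem _).2 ⟨_, h3, by simp [blockInclusion]⟩,
        (hmem _).2 ⟨_, h2, by simp [blockInclusion]⟩⟩, fun v hv => ?_⟩⟩
      obtain ⟨x, -, rfl⟩ := (hmem v).1 hv
      simp only [blockInclusion]
      split_ifs <;> simp

/-- The `l`-th facet of the simplex in layer `m`. -/
def layerFace (l : Fin (d + 1)) (m : Fin (n + 1)) : Finset (Fin (d + 1) × Fin (n + 1)) :=
  Finset.univ.erase l ×ˢ {m}

theorem mem_layerFace {l : Fin (d + 1)} {m : Fin (n + 1)} {v : Fin (d + 1) × Fin (n + 1)} :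
    v ∈ layerFace l m ↔ v.1 ≠ l ∧ v.2 = m := by
  simp only [layerFace, Finset.mem_product, Finset.mem_erase, Finset.mem_univ, and_true,
    Finset.mem_singleton]

theorem card_layerFace (l : Fin (d + 1)) (m : Fin (n + 1)) : (layerFace l m).card = d := by
  simp [layerFace]

theorem layerFace_injective (m : Fin (n + 1)) :
    Injective fun l : Fin (d + 1) => layerFace l m := by
  intro l l' h
  by_contra hne
  have h1 : (l, m) ∈ layerFace l' m := mem_layerFace.2 ⟨hne, rfl⟩
  have h2 : (l, m) ∈ layerFace l m := by
    rw [show layerFace l m = layerFace l' m from h]; exact h1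
  exact (mem_layerFace.1 h2).1 rfl

theorem stellarBottom_mem_stackedComplex (m : Fin n) (i : Fin (d + 1))
    {s : Finset (Fin (d + 1) × Fin (n + 1))}
    (hs : ∀ v, v ∈ s ↔ v = (i, m.castSucc) ∨ v.1 ≠ i ∧ v.2 = m.succ) :
    s ∈ (stackedComplex d n).faces := by
  refine mem_stackedComplex_of_block m (t := insert (i, 1) (Finset.univ.erase i ×ˢ {0}))
    ⟨i, Finset.insert_nonempty _ _, Or.inr (Finset.Subset.refl _)⟩ fun v => ?_
  rw [hs]
  constructor
  · rintro (rfl | ⟨h1, h2⟩)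
    · exact ⟨(i, 1), by simp, by simp [blockInclusion]⟩
    · exact ⟨(v.1, 0), by simp [h1], by ext <;> simp [blockInclusion, h2]⟩
  · rintro ⟨⟨a, b⟩, hx, rfl⟩
    simp only [Finset.mem_insert, Prod.mk.injEq, Finset.mem_product, Finset.mem_erase,
      Finset.mem_univ, and_true, Finset.mem_singleton] at hx
    rcases hx with ⟨rfl, rfl⟩ | ⟨ha, rfl⟩
    · exact Or.inl (by simp [blockInclusion])
    · exact Or.inr ⟨ha, by simp [blockInclusion]⟩

theorem layerFace_mem_stackedComplex (hd : 1 ≤ d) (l : Fin (d + 1)) (m : Fin n) :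
    layerFace l m.succ ∈ (stackedComplex d n).faces := by
  have h := stellarBottom_mem_stackedComplex m l
    (s := insert (l, m.castSucc) (layerFace l m.succ)) fun v => by
      rw [Finset.mem_insert, mem_layerFace]
  refine ((stackedComplex d n).isRelLowerSet_faces h).2 (Finset.subset_insert _ _) ?_
  rw [← Finset.card_pos, card_layerFace]
  omega

end Stacked

/-! ### The volume form on the facets of a simplex. -/

section VolumeForm

open Function

variable {d : ℕ}

/-- The alternating form `det (1, x_1, …, x_d)` on `ℝ ^ (d + 1)`. -/
noncomputable def volumeForm (d : ℕ) : (Fin (d + 1) → ℝ) [⋀^Fin d]→ₗ[ℝ] ℝ :=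
  (Matrix.detRowAlternating (R := ℝ) (n := Fin (d + 1))).curryLeft fun _ => 1

theorem faceTerm_volumeForm (y : Fin (d + 1) → Fin (d + 1) → ℝ) (l : Fin (d + 1)) :
    faceTerm (volumeForm d) y l = Matrix.det (update y l fun _ => 1) := by
  have h := AlternatingMap.map_insertNth (Matrix.detRowAlternating (R := ℝ) (n := Fin (d + 1))) l
    (fun _ => 1) (l.removeNth y)
  rw [Fin.insertNth_removeNth] at h
  change _ = Matrix.detRowAlternating _
  rw [h, faceTerm, volumeForm, AlternatingMap.curryLeft_apply_apply]
  simp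

/-- The all-ones vector is the sum of the rows, so putting it in place of any row leaves the
determinant unchanged. All facets thus contribute equally to the coboundary. -/
theorem faceTerm_volumeForm_vertexVec (p : Equiv.Perm (Fin (d + 1))) (l : Fin (d + 1)) :
    faceTerm (volumeForm d) (fun i => vertexVec (p i)) l = (Equiv.Perm.sign p : ℝ) := by
  set A : Matrix (Fin (d + 1)) (Fin (d + 1)) ℝ := fun i => vertexVec (p i) with hA
  have h1 : (fun _ => 1 : Fin (d + 1) → ℝ) = ∑ k, (1 : ℝ) • A k := by
    ext j
    rw [Finset.sum_apply, Finset.sum_eq_single (p.symm j)]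
    · simp [hA, vertexVec_self]
    · intro k _ hk
      rw [one_smul, hA]
      refine vertexVec_of_ne fun h => hk ?_
      rw [h, Equiv.symm_apply_apply]
    · simp
  have hdet : A.det = (Equiv.Perm.sign p : ℝ) := by
    have h2 : A = fun i => (1 : Matrix (Fin (d + 1)) (Fin (d + 1)) ℝ) (p i) := by
      ext i j
      by_cases hj : j = p i
      · rw [hj, Matrix.one_apply_eq]; exact vertexVec_self _
      · rw [Matrix.one_apply_ne (Ne.symm hj)]; exact vertexVec_of_ne hj
    rw [h2]
    exact (Matrix.det_permute p 1).trans (by simp)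
  rw [faceTerm_volumeForm, h1, ← hdet]
  exact (Matrix.det_updateRow_sum A l fun _ => 1).trans (by simp)

end VolumeForm

/-! ### The test cochain and its coboundary. -/

section StackedGap

open Function

variable {d n : ℕ}

/-- A linear order on the vertices takes precedence over the product order. -/
abbrev preorderOfLinearOrder [L : LinearOrder (Fin (d + 1) × Fin (n + 1))] :
    Preorder (Fin (d + 1) × Fin (n + 1)) := L.toPreorder

/-- The decidable equality of a linear order on the vertices. -/
abbrev decidableEqOfLinearOrder [L : LinearOrder (Fin (d + 1) × Fin (n + 1))] :
    DecidableEq (Fin (d + 1) × Fin (n + 1)) := L.toDecidableEq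

/-- The comparison of a linear order on the vertices. -/
abbrev ltOfLinearOrder [L : LinearOrder (Fin (d + 1) × Fin (n + 1))] :
    LT (Fin (d + 1) × Fin (n + 1)) := L.toLT

attribute [local instance] preorderOfLinearOrder decidableEqOfLinearOrder ltOfLinearOrder

/-- The lowest layer of a set of vertices. -/
noncomputable def minLayer (s : Finset (Fin (d + 1) × Fin (n + 1))) : ℕ :=
  sInf {k | ∃ v ∈ s, v.2.val = k}

theorem minLayer_eq {s : Finset (Fin (d + 1) × Fin (n + 1))} {k : ℕ}
    (h : ∃ v ∈ s, v.2.val = k) (hk : ∀ v ∈ s, k ≤ v.2.val) : minLayer s = k :=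
  IsLeast.csInf_eq ⟨h, by rintro _ ⟨v, hv, rfl⟩; exact hk v hv⟩

variable [LinearOrder (Fin (d + 1) × Fin (n + 1))]

/-- On a cocycle of the stacked complex, the boundary of the simplex in any layer vanishes. -/
theorem sum_layerFace_eq_zero_of_cocycle
    (hord : ∀ (m : Fin (n + 1)) (u v : Fin (d + 1)), u < v → (u, m) < (v, m))
    (g : Finset (Fin (d + 1) × Fin (n + 1)) → ℝ)
    (hg : ∀ s ∈ (stackedComplex d n).faces, s.card = d + 1 →
      ∑ v ∈ s, (-1 : ℝ) ^ (s.filter (· < v)).card * g (s.erase v) = 0) (m : Fin (n + 1)) :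
    ∑ l : Fin (d + 1), (-1 : ℝ) ^ (l : ℕ) * g (layerFace l m) = 0 := by
  rw [← sum_faceTerm_cochainForm g (y := fun v => (v, m)) (fun u v h => hord m u v h)
    (fun l v => by
      rw [mem_layerFace]
      exact ⟨fun h => ⟨v.1, h.1, by rw [← h.2]⟩, by rintro ⟨j, hj, rfl⟩; exact ⟨hj, rfl⟩⟩)]
  induction m using Fin.induction with
  | zero =>
    refine sum_faceTerm_eq_zero_of_cocycle g hg (s := Finset.univ ×ˢ {0})
      (Or.inl ⟨⟨(0, 0), by simp⟩, Finset.Subset.refl _⟩) fun v => ?_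
    simp only [Finset.mem_product, Finset.mem_univ, true_and, Finset.mem_singleton]
    exact ⟨fun h => ⟨v.1, by rw [← h]⟩, by rintro ⟨j, rfl⟩; rfl⟩
  | succ m ih =>
    have h := sum_faceTerm_bottom_eq (cochainForm d g)
      (fun x => vertexVec (blockInclusion d m x)) fun y hy =>
        sum_faceTerm_eq_zero_of_cocycle g hg (y := fun i => blockInclusion d m (y i))
          (s := (Finset.univ.image y).map ⟨_, blockInclusion_injective m⟩)
          (mem_stackedComplex_of_block m hy fun v => by simp) fun v => by simp
    have h0 : ∀ v : Fin (d + 1), blockInclusion d m (v, 0) = (v, m.succ) := fun _ => rfl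
    have h1 : ∀ v : Fin (d + 1), blockInclusion d m (v, 1) = (v, m.castSucc) := fun _ => rfl
    simp only [h0, h1] at h
    rw [h, ih, mul_zero]

/-- The pullback of the volume form to the increasingly ordered simplices. -/
noncomputable def projVolume (s : Finset (Fin (d + 1) × Fin (n + 1))) : ℝ :=
  if h : s.card = d then volumeForm d fun i => vertexVec (s.orderEmbOfFin h i).1 else 0

/-- The cochain that is multiplied by `-d` from each layer to the next. -/
noncomputable def layerCochain (s : Finset (Fin (d + 1) × Fin (n + 1))) : ℝ :=
  (-d) ^ minLayer s * projVolume s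

theorem projVolume_eq {y : Fin (d + 1) → Fin (d + 1) × Fin (n + 1)} (hy : StrictMono y)
    (l : Fin (d + 1)) {t : Finset (Fin (d + 1) × Fin (n + 1))}
    (ht : ∀ v, v ∈ t ↔ ∃ j, j ≠ l ∧ y j = v) :
    (-1) ^ (l : ℕ) * projVolume t = faceTerm (volumeForm d) (fun i => vertexVec (y i).1) l := by
  have hmono : StrictMono fun i => y (l.succAbove i) := hy.comp (Fin.strictMono_succAbove l)
  have hcard : t.card = d := by
    have : t = Finset.univ.map ⟨_, hmono.injective⟩ := by
      ext v
      simp only [ht, Finset.mem_map, Finset.mem_univ, true_and, Embedding.coeFn_mk]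
      constructor
      · rintro ⟨j, hj, rfl⟩
        obtain ⟨i, rfl⟩ := Fin.exists_succAbove_eq hj
        exact ⟨i, rfl⟩
      · rintro ⟨i, rfl⟩
        exact ⟨_, Fin.succAbove_ne l i, rfl⟩
    rw [this, Finset.card_map, Finset.card_univ, Fintype.card_fin]
  have := Finset.orderEmbOfFin_unique hcard
    (fun i => (ht _).2 ⟨l.succAbove i, Fin.succAbove_ne l i, rfl⟩) hmono
  rw [projVolume, dif_pos hcard, faceTerm, ← this]
  rfl

theorem coboundary_layerCochain {s : Finset (Fin (d + 1) × Fin (n + 1))} (h : s.card = d + 1) :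
    ∑ v ∈ s, (-1 : ℝ) ^ (s.filter (· < v)).card * layerCochain (s.erase v) =
      ∑ l, (-d) ^ minLayer (s.erase (s.orderEmbOfFin h l)) *
        faceTerm (volumeForm d) (fun i => vertexVec (s.orderEmbOfFin h i).1) l := by
  rw [sum_neg_one_pow_card_filter (fun v => layerCochain (s.erase v)) h]
  refine Finset.sum_congr rfl fun l _ => ?_
  rw [layerCochain, mul_left_comm, projVolume_eq (s.orderEmbOfFin h).strictMono]
  intro v
  rw [Finset.mem_erase]
  constructor
  · rintro ⟨hv, hvs⟩
    obtain ⟨i, rfl⟩ : v ∈ Set.range (s.orderEmbOfFin h) := by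
      rw [Finset.range_orderEmbOfFin]; exact hvs
    exact ⟨i, fun hi => hv (by rw [hi]), rfl⟩
  · rintro ⟨j, hj, rfl⟩
    exact ⟨fun h' => hj ((s.orderEmbOfFin h).injective h'), Finset.orderEmbOfFin_mem s h j⟩

/-- A simplex whose projection is onto is, up to the order, a permutation. -/
theorem exists_perm_of_surjective {s : Finset (Fin (d + 1) × Fin (n + 1))} (h : s.card = d + 1)
    (hs : ∀ i, ∃ v ∈ s, v.1 = i) :
    ∃ p : Equiv.Perm (Fin (d + 1)), ∀ i, (s.orderEmbOfFin h i).1 = p i := by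
  have hsurj : Surjective fun i => (s.orderEmbOfFin h i).1 := by
    intro i
    obtain ⟨v, hv, rfl⟩ := hs i
    obtain ⟨j, rfl⟩ : v ∈ Set.range (s.orderEmbOfFin h) := by
      rw [Finset.range_orderEmbOfFin]; exact hv
    exact ⟨j, rfl⟩
  exact ⟨Equiv.ofBijective _ (Finite.surjective_iff_bijective.1 hsurj), fun i => rfl⟩

/-- On a simplex over the bottom of a stellar prism, the `d` facets through the cone vertex have
weight `(-d)^m` and the opposite one `(-d)^(m+1)`, which sum to zero. Any other simplex has two
vertices over the same `w`: the volume form vanishes on facets containing both, and the two facets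
that omit one of them cancel, having equal weights because the cone vertex `(i, m)` stays in each.
-/
theorem coboundary_layerCochain_eq_zero {s : Finset (Fin (d + 1) × Fin (n + 1))}
    (hs : s ∈ (stackedComplex d n).faces) (hcard : s.card = d + 1) (hd : 1 ≤ d)
    (h0 : s ≠ Finset.univ ×ˢ {0}) :
    ∑ v ∈ s, (-1 : ℝ) ^ (s.filter (· < v)).card * layerCochain (s.erase v) = 0 := by
  rw [coboundary_layerCochain hcard]
  set y := s.orderEmbOfFin hcard with hy
  have hys : ∀ v ∈ s, ∃ i, y i = v := by
    intro v hv
    have : v ∈ Set.range y := by rw [Finset.range_orderEmbOfFin]; exact hv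
    exact this
  obtain h | ⟨m, i, h | ⟨⟨w, hwi, h1, h2, h3⟩, hle⟩⟩ := stackedComplex_top_cases hs hcard
  · exact absurd h h0
  · obtain ⟨p, hp⟩ := exists_perm_of_surjective hcard fun j => by
      by_cases hj : j = i
      · exact ⟨(i, m.castSucc), (h _).2 (Or.inl rfl), hj.symm⟩
      · exact ⟨(j, m.succ), (h _).2 (Or.inr ⟨hj, rfl⟩), rfl⟩
    have hterm : ∀ l, faceTerm (volumeForm d) (fun i => vertexVec (y i).1) l =
        (Equiv.Perm.sign p : ℝ) := by
      intro l
      simp_rw [hy, hp]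
      exact faceTerm_volumeForm_vertexVec p l
    obtain ⟨l₀, hl₀⟩ := hys (i, m.castSucc) ((h _).2 (Or.inl rfl))
    have hlow : ∀ l, l ≠ l₀ → minLayer (s.erase (y l)) = m := by
      intro l hl
      refine minLayer_eq ⟨(i, m.castSucc), Finset.mem_erase.2 ⟨fun h' => hl ?_, (h _).2 (Or.inl rfl)⟩,
        rfl⟩ fun v hv => ?_
      · exact y.injective (h'.symm.trans hl₀.symm)
      · rcases (h v).1 (Finset.mem_of_mem_erase hv) with rfl | ⟨-, hv'⟩
        · exact le_rfl
        · rw [hv', Fin.val_succ]; omega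
    rw [← Finset.add_sum_erase _ _ (Finset.mem_univ l₀)]
    rw [Finset.sum_congr rfl fun l hl => by rw [hlow l (Finset.ne_of_mem_erase hl), hterm],
      Finset.sum_const, Finset.card_erase_of_mem (Finset.mem_univ _), Finset.card_univ,
      Fintype.card_fin, hterm, hl₀, Nat.add_sub_cancel, nsmul_eq_mul]
    have hhigh : minLayer (s.erase (i, m.castSucc)) = m + 1 := by
      obtain ⟨j, hj⟩ : ∃ j : Fin (d + 1), j ≠ i := by
        have : Nontrivial (Fin (d + 1)) := Fin.nontrivial_iff_two_le.2 (by omega)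
        exact exists_ne i
      refine minLayer_eq ⟨(j, m.succ), Finset.mem_erase.2 ⟨fun h' => hj (Prod.mk.inj h').1,
        (h _).2 (Or.inr ⟨hj, rfl⟩)⟩, Fin.val_succ m⟩ fun v hv => ?_
      obtain ⟨hv1, hv2⟩ := Finset.mem_erase.1 hv
      rw [(((h v).1 hv2).resolve_left hv1).2, Fin.val_succ]
    rw [hhigh, pow_succ]
    ring
  · obtain ⟨a, ha⟩ := hys _ h1
    obtain ⟨b, hb⟩ := hys _ h2
    obtain ⟨c, hc⟩ := hys _ h3
    have hbc : b ≠ c := by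
      rintro rfl
      have := congrArg (fun v => (Prod.snd v).val) (hb.symm.trans hc)
      simp at this
    have hab : a ≠ b := by
      rintro rfl
      exact hwi (congrArg Prod.fst (hb.symm.trans ha))
    have hac : a ≠ c := by
      rintro rfl
      exact hwi (congrArg Prod.fst (hc.symm.trans ha))
    have heq : vertexVec (y b).1 = vertexVec (y c).1 := by rw [hb, hc]
    have hlow : ∀ l, l ≠ a → minLayer (s.erase (y l)) = m := by
      intro l hl
      refine minLayer_eq ⟨(i, m.castSucc), Finset.mem_erase.2 ⟨fun h' => hl ?_, h1⟩, rfl⟩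
        fun v hv => hle v (Finset.mem_of_mem_erase hv)
      exact y.injective (h'.symm.trans ha.symm)
    rw [Fintype.sum_eq_add b c hbc fun l hl => by
      rw [faceTerm_eq_zero_of_eq _ hbc (Ne.symm hl.1) (Ne.symm hl.2) heq, mul_zero],
      hlow b hab.symm, hlow c hac.symm, ← mul_add,
      faceTerm_add_eq_zero_of_eq (volumeForm d) hbc heq, mul_zero]

/-- The `d + 1` facets have weight one and contribute the same sign. That sign depends on the vertex
order, so only the square is recorded. -/
theorem sq_coboundary_layerCochain_bottom
    (hcard : (Finset.univ ×ˢ {0} : Finset (Fin (d + 1) × Fin (n + 1))).card = d + 1)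
    (hd : 1 ≤ d) :
    (∑ v ∈ (Finset.univ ×ˢ {0} : Finset (Fin (d + 1) × Fin (n + 1))),
      (-1 : ℝ) ^ (Finset.filter (· < v) (Finset.univ ×ˢ {0})).card *
        layerCochain ((Finset.univ ×ˢ {0} : Finset (Fin (d + 1) × Fin (n + 1))).erase v)) ^ 2 =
      (d + 1) ^ 2 := by
  rw [coboundary_layerCochain hcard]
  obtain ⟨p, hp⟩ := exists_perm_of_surjective hcard fun j => ⟨(j, 0), by simp, rfl⟩
  simp_rw [hp, faceTerm_volumeForm_vertexVec]
  have hlow : ∀ l, minLayer (((Finset.univ ×ˢ {0} : Finset (Fin (d + 1) × Fin (n + 1)))).erase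
      (Finset.orderEmbOfFin _ hcard l)) = 0 := by
    intro l
    have hne : (((Finset.univ ×ˢ {0} : Finset (Fin (d + 1) × Fin (n + 1)))).erase
      (Finset.orderEmbOfFin _ hcard l)).Nonempty := by
      rw [← Finset.card_pos, Finset.card_erase_of_mem (Finset.orderEmbOfFin_mem _ _ _), hcard]
      omega
    obtain ⟨v, hv⟩ := hne
    have hv2 := (Finset.mem_product.1 (Finset.mem_of_mem_erase hv)).2
    exact minLayer_eq ⟨v, hv, by rw [Finset.mem_singleton.1 hv2]; rfl⟩ fun _ _ => Nat.zero_le _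
  simp_rw [hlow, pow_zero, one_mul, Finset.sum_const, Finset.card_univ, Fintype.card_fin,
    nsmul_eq_mul, mul_pow]
  rcases Int.units_eq_one_or (Equiv.Perm.sign p) with h | h <;> simp [h]

theorem sum_layerCochain_layerFace
    (hord : ∀ (m : Fin (n + 1)) (u v : Fin (d + 1)), u < v → (u, m) < (v, m)) (hd : 1 ≤ d)
    (m : Fin (n + 1)) :
    ∑ l : Fin (d + 1), (-1 : ℝ) ^ (l : ℕ) * layerCochain (layerFace l m) =
      (-d) ^ (m : ℕ) * (d + 1) := by
  have hterm : ∀ l : Fin (d + 1), (-1 : ℝ) ^ (l : ℕ) * layerCochain (layerFace l m) =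
      (-d) ^ (m : ℕ) := by
    intro l
    have hmin : minLayer (layerFace l m) = m := by
      obtain ⟨v, hv⟩ : (layerFace l m).Nonempty := by
        rw [← Finset.card_pos, card_layerFace]; omega
      refine minLayer_eq ⟨v, hv, by rw [(mem_layerFace.1 hv).2]⟩ fun v hv => ?_
      rw [(mem_layerFace.1 hv).2]
    rw [layerCochain, hmin, mul_left_comm, projVolume_eq (y := fun v => (v, m))
      (fun u v h => hord m u v h) l fun v => ?_]
    · have := faceTerm_volumeForm_vertexVec (Equiv.refl (Fin (d + 1))) l
      simp only [Equiv.refl_apply, Equiv.Perm.sign_refl] at this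
      rw [this]; simp
    · rw [mem_layerFace]
      exact ⟨fun h => ⟨v.1, h.1, by rw [← h.2]⟩, by rintro ⟨j, hj, rfl⟩; exact ⟨hj, rfl⟩⟩
  simp_rw [hterm]
  simp [mul_comm]

end StackedGap

/-! ### The small eigenvalue of the stacked complex. -/

section Eigenvalue

open Function Module.End

variable {e n : ℕ} [LinearOrder (Fin (e + 1 + 1) × Fin (n + 1))]

attribute [local instance] preorderOfLinearOrder decidableEqOfLinearOrder ltOfLinearOrder

theorem transpose_boundary_mulVec_apply {V : Type*} [LinearOrder V]
    {K : PreAbstractSimplicialComplex V} [Finite K.faces] {k : ℕ} (g : Finset V → ℝ)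
    (σ : Simplex K (k + 1)) :
    (boundary K k).transpose.mulVec (fun τ => g τ.1) σ =
      ∑ v ∈ σ.1, (-1 : ℝ) ^ (σ.1.filter (· < v)).card * g (σ.1.erase v) := by
  rw [← sum_mul_boundary g σ]
  exact Finset.sum_congr rfl fun τ _ => mul_comm _ _

/-- The upper Laplacian of the stacked complex has an exponentially small non-zero eigenvalue. -/
theorem exists_eigenvalue_upLaplacian_stackedComplex
    (hord : ∀ (m : Fin (n + 1)) (u v : Fin (e + 1 + 1)), u < v → (u, m) < (v, m)) (hn : 1 ≤ n) :
    ∃ μ : ℝ, μ ≠ 0 ∧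
      HasEigenvalue (Matrix.toLin' (upLaplacian (stackedComplex (e + 1) n) e)) μ ∧
      μ * ((e : ℝ) + 1) ^ (2 * n) ≤ e + 2 := by
  set K := stackedComplex (e + 1) n with hK
  have hface : ∀ l : Fin (e + 1 + 1), layerFace l (Fin.last n) ∈ K.faces := by
    intro l
    obtain ⟨k, rfl⟩ : ∃ k, n = k + 1 := ⟨n - 1, by omega⟩
    rw [← Fin.succ_last]
    exact layerFace_mem_stackedComplex (by omega) l _
  set face : Fin (e + 1 + 1) → Simplex K e :=
    fun l => ⟨layerFace l (Fin.last n), hface l, card_layerFace l _⟩ with hfacedef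
  have hfaceinj : Injective face := fun l l' h =>
    layerFace_injective (Fin.last n) (congrArg Subtype.val h)
  -- The boundary chain of the last layer's simplex, whether or not that simplex is a face.
  set z : Simplex K e → ℝ := fun τ => ∑ l, if face l = τ then (-1 : ℝ) ^ (l : ℕ) else 0 with hz
  have hdot : ∀ f : Simplex K e → ℝ, f ⬝ᵥ z = ∑ l : Fin (e + 1 + 1), (-1) ^ (l : ℕ) * f (face l) := by
    intro f
    simp only [hz, dotProduct, Finset.mul_sum]
    rw [Finset.sum_comm]
    refine Finset.sum_congr rfl fun l _ => ?_
    rw [Finset.sum_eq_single (face l)]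
    · rw [if_pos rfl, mul_comm]
    · intro τ _ hτ
      rw [if_neg (Ne.symm hτ), mul_zero]
    · simp
  have hzz : z ⬝ᵥ z = e + 2 := by
    rw [hdot]
    have : ∀ l : Fin (e + 1 + 1), (-1 : ℝ) ^ (l : ℕ) * z (face l) = 1 := by
      intro l
      simp only [hz]
      rw [Finset.sum_eq_single l (fun l' _ hl' => if_neg fun h => hl' (hfaceinj h)) (by simp),
        if_pos rfl, ← pow_add, ← two_mul, pow_mul]
      simp
    simp_rw [this]
    simp
    ring
  set u : Simplex K e → ℝ := fun τ => layerCochain τ.1 with hu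
  have huz : u ⬝ᵥ z = (-((e + 1 : ℕ) : ℝ)) ^ n * (((e + 1 : ℕ) : ℝ) + 1) := by
    rw [hdot]
    simpa using sum_layerCochain_layerFace hord (by omega) (Fin.last n)
  have hzker : ∀ f, (boundary K e).transpose.mulVec f = 0 → f ⬝ᵥ z = 0 := by
    intro f hf
    classical
    set g : Finset (Fin (e + 1 + 1) × Fin (n + 1)) → ℝ := fun s =>
      if h : s ∈ K.faces ∧ s.card = e + 1 then f ⟨s, h⟩ else 0 with hg
    have hfg : f = fun τ => g τ.1 := by
      ext τ
      simp only [hg]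
      rw [dif_pos τ.2]
    rw [hdot, hfg]
    refine sum_layerFace_eq_zero_of_cocycle hord g (fun s hs hcard => ?_) (Fin.last n)
    have := congrFun hf ⟨s, hs, hcard⟩
    rw [hfg, transpose_boundary_mulVec_apply] at this
    exact this
  have hbot : (Finset.univ ×ˢ {0} : Finset (Fin (e + 1 + 1) × Fin (n + 1))).card = e + 1 + 1 := by
    simp
  have hBu : (boundary K e).transpose.mulVec u ⬝ᵥ (boundary K e).transpose.mulVec u =
      (((e + 1 : ℕ) : ℝ) + 1) ^ 2 := by
    have hmem : (Finset.univ ×ˢ {0} : Finset (Fin (e + 1 + 1) × Fin (n + 1))) ∈ K.faces :=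
      Or.inl ⟨⟨(0, 0), by simp⟩, Finset.Subset.refl _⟩
    rw [← sq_coboundary_layerCochain_bottom hbot (by omega), dotProduct,
      Finset.sum_eq_single (⟨_, hmem, hbot⟩ : Simplex K (e + 1))]
    · rw [hu, transpose_boundary_mulVec_apply, sq]
    · intro σ _ hσ
      rw [hu, transpose_boundary_mulVec_apply,
        coboundary_layerCochain_eq_zero σ.2.1 σ.2.2 (by omega) fun h => hσ (Subtype.ext h),
        mul_zero]
    · simp
  have hpos : (0 : ℝ) < ((e + 1 : ℕ) : ℝ) + 1 := by positivity
  obtain ⟨μ, h0, hev, hle⟩ := exists_eigenvalue_mul_transpose_le (boundary K e) u z hzker (by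
    rw [huz]
    refine mul_ne_zero (pow_ne_zero _ (neg_ne_zero.2 ?_)) hpos.ne'
    positivity)
  refine ⟨μ, h0, hev, ?_⟩
  rw [huz, hBu, hzz, mul_pow, ← pow_mul, mul_comm n 2, pow_mul, neg_sq, ← pow_mul] at hle
  have h2 : μ * ((e + 1 : ℕ) : ℝ) ^ (2 * n) * (((e + 1 : ℕ) : ℝ) + 1) ^ 2 ≤
      (e + 2) * (((e + 1 : ℕ) : ℝ) + 1) ^ 2 := by linarith
  have h3 := le_of_mul_le_mul_right h2 (by positivity)
  push_cast at h3
  exact h3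

end Eigenvalue

/-! ### A proper coloring with few colors. -/

section Coloring

variable {d n p : ℕ}

/-- The polynomial whose coefficients are the base `p` digits of `m`, evaluated at `x`. -/
def digitPolynomial (p d m : ℕ) (x : ZMod p) : ZMod p :=
  ∑ k : Fin d, x ^ (k : ℕ) * ((m / p ^ (k : ℕ) : ℕ) : ZMod p)

/-- The coefficients are the full quotients modulo `p`, so carries need no bookkeeping: a quotient
increases by one exactly when `p ^ k` divides `m + 1`. -/
theorem digitPolynomial_succ (m : ℕ) (x : ZMod p) :
    digitPolynomial p d (m + 1) x = digitPolynomial p d m x +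
      ∑ k : Fin d, x ^ (k : ℕ) * if p ^ (k : ℕ) ∣ m + 1 then 1 else 0 := by
  rw [digitPolynomial, digitPolynomial, ← Finset.sum_add_distrib]
  refine Finset.sum_congr rfl fun k _ => ?_
  rw [Nat.succ_div]
  split_ifs <;> push_cast <;> ring

theorem eq_of_digits_eq : ∀ (d : ℕ) {m m' : ℕ}, m < p ^ d → m' < p ^ d →
    (∀ k < d, ((m / p ^ k : ℕ) : ZMod p) = ((m' / p ^ k : ℕ) : ZMod p)) → m = m'
  | 0, m, m', hm, hm', _ => by simp at hm hm'; omega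
  | d + 1, m, m', hm, hm', h => by
    have h0 := h 0 (Nat.succ_pos d)
    simp only [pow_zero, Nat.div_one] at h0
    have h1 : m % p = m' % p := (ZMod.natCast_eq_natCast_iff' m m' p).1 h0
    have h2 : m / p = m' / p := by
      refine eq_of_digits_eq d ?_ ?_ fun k hk => ?_
      · exact Nat.div_lt_of_lt_mul (by rwa [← pow_succ'])
      · exact Nat.div_lt_of_lt_mul (by rwa [← pow_succ'])
      · rw [Nat.div_div_eq_div_mul, Nat.div_div_eq_div_mul, ← pow_succ']
        exact h (k + 1) (by omega)
    rw [← Nat.div_add_mod m p, ← Nat.div_add_mod m' p, h1, h2]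

/-- The point at which the digit polynomial of the layer is evaluated. -/
def colorPoint (p : ℕ) (v : Fin (d + 1) × Fin (n + 1)) : ZMod p :=
  ((3 * v.1.val + v.2.val % 3 : ℕ) : ZMod p)

/-- The colors: an index of a vertex, the residue of the layer modulo three, the powers of `p`
dividing the layer, and a value of the digit polynomial. -/
abbrev Palette (d p : ℕ) : Type := Fin (d + 1) × Fin 3 × (Fin d → Bool) × ZMod p

/-- The color of a vertex of the stacked complex. -/
def paletteColor (p : ℕ) (v : Fin (d + 1) × Fin (n + 1)) : Palette d p :=
  (v.1, ⟨v.2.val % 3, Nat.mod_lt _ (by norm_num)⟩, fun k => decide (p ^ (k : ℕ) ∣ v.2.val),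
    digitPolynomial p d v.2.val (colorPoint p v))

theorem paletteColor_eq {v w : Fin (d + 1) × Fin (n + 1)} (h : paletteColor p v = paletteColor p w) :
    v.1 = w.1 ∧ v.2.val % 3 = w.2.val % 3 ∧
      (∀ k : Fin d, p ^ (k : ℕ) ∣ v.2.val ↔ p ^ (k : ℕ) ∣ w.2.val) ∧ colorPoint p v = colorPoint p w ∧
      digitPolynomial p d v.2.val (colorPoint p v) =
        digitPolynomial p d w.2.val (colorPoint p v) := by
  simp only [paletteColor, Prod.mk.injEq, Fin.mk.injEq] at h
  obtain ⟨h1, h2, h3, h4⟩ := h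
  have h5 : colorPoint p v = colorPoint p w := by rw [colorPoint, colorPoint, h1, h2]
  refine ⟨h1, h2, fun k => ?_, h5, ?_⟩
  · simpa using congrFun h3 k
  · rw [h4, h5]

/-- The vertices of a simplex lie in two consecutive layers. -/
theorem exists_top_layer {s : Finset (Fin (d + 1) × Fin (n + 1))}
    (hs : s ∈ (stackedComplex d n).faces) :
    ∃ M, (∃ v ∈ s, v.2.val = M) ∧ ∀ v ∈ s, v.2.val = M ∨ v.2.val + 1 = M := by
  obtain ⟨v₀, hv₀⟩ := ((stackedComplex d n).isRelLowerSet_faces hs).1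
  rcases exists_of_mem_stackedComplex hs with h | ⟨m, t, -, -, hmem⟩
  · have h0 : ∀ v ∈ s, v.2.val = 0 := fun v hv => by
      rw [Finset.mem_singleton.1 (Finset.mem_product.1 (h hv)).2]; rfl
    exact ⟨0, ⟨v₀, hv₀, h0 _ hv₀⟩, fun v hv => Or.inl (h0 v hv)⟩
  · have h0 : ∀ v ∈ s, v.2.val = m + 1 ∨ v.2.val = m := fun v hv => by
      obtain ⟨x, -, rfl⟩ := (hmem v).1 hv
      simp only [blockInclusion]
      split_ifs <;> simp
    by_cases hex : ∃ v ∈ s, v.2.val = m + 1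
    · exact ⟨m + 1, hex, fun v hv => (h0 v hv).imp id fun h => by omega⟩
    · push Not at hex
      have h1 : ∀ v ∈ s, v.2.val = m := fun v hv => (h0 v hv).resolve_left (hex v hv)
      exact ⟨m, ⟨v₀, hv₀, h1 _ hv₀⟩, fun v hv => Or.inl (h1 v hv)⟩

theorem eq_of_residues_eq {s : Finset (Fin (d + 1) × Fin (n + 1))}
    (hs : s ∈ (stackedComplex d n).faces) {v w : Fin (d + 1) × Fin (n + 1)} (hv : v ∈ s)
    (hw : w ∈ s) (h1 : v.1 = w.1) (h2 : v.2.val % 3 = w.2.val % 3) : v = w := by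
  obtain ⟨M, -, hM⟩ := exists_top_layer hs
  refine Prod.ext h1 (Fin.ext ?_)
  rcases hM v hv with h | h <;> rcases hM w hw with h' | h' <;> omega

theorem colorPoint_injOn (hp : 3 * (d + 1) ≤ p) {s : Finset (Fin (d + 1) × Fin (n + 1))}
    (hs : s ∈ (stackedComplex d n).faces) : Set.InjOn (colorPoint p) (s : Set (Fin (d + 1) × Fin (n + 1))) := by
  intro v hv w hw h
  have hlt : ∀ x : Fin (d + 1) × Fin (n + 1), 3 * x.1.val + x.2.val % 3 < p := fun x => by
    have := x.1.isLt
    omega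
  have h' := (ZMod.natCast_eq_natCast_iff' _ _ p).1 h
  rw [Nat.mod_eq_of_lt (hlt v), Nat.mod_eq_of_lt (hlt w)] at h'
  exact eq_of_residues_eq hs hv hw (Fin.ext (by omega)) (by omega)

/-- The `(d - 1)`-simplices are determined by their colors. -/
theorem eq_of_paletteColor_subset [Fact p.Prime] (hp : 3 * (d + 1) ≤ p) (hn : n < p ^ d)
    {s t : Finset (Fin (d + 1) × Fin (n + 1))} (hs : s ∈ (stackedComplex d n).faces)
    (ht : t ∈ (stackedComplex d n).faces) (hsd : s.card = d) (htd : t.card = d)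
    (hst : ∀ v ∈ s, ∃ w ∈ t, paletteColor p v = paletteColor p w)
    (hts : ∀ w ∈ t, ∃ v ∈ s, paletteColor p v = paletteColor p w) : s = t := by
  obtain ⟨M, ⟨v₀, hv₀, hv₀M⟩, hM⟩ := exists_top_layer hs
  obtain ⟨M', ⟨w₀, hw₀, hw₀M⟩, hM'⟩ := exists_top_layer ht
  obtain ⟨w₁, hw₁, h₁⟩ := hst v₀ hv₀
  obtain ⟨v₁, hv₁, h₂⟩ := hts w₀ hw₀
  obtain ⟨-, hr₁, hdvd, -⟩ := paletteColor_eq h₁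
  obtain ⟨-, hr₂, -⟩ := paletteColor_eq h₂
  -- If a top layer matched the lower layer of the other simplex, each would be one less than the
  -- other modulo three, which is impossible; modulo two this would fail.
  have hmod : M % 3 = M' % 3 := by
    rcases hM' w₁ hw₁ with h | h <;> rcases hM v₁ hv₁ with h' | h' <;> omega
  have hw₁M : w₁.2.val = M' := by
    rcases hM' w₁ hw₁ with h | h <;> omega
  rw [hv₀M, hw₁M] at hdvd
  have hlayer : ∀ v ∈ s, ∃ w ∈ t, v.1 = w.1 ∧
      (v.2.val = M ∧ w.2.val = M' ∨ v.2.val + 1 = M ∧ w.2.val + 1 = M') ∧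
      digitPolynomial p d v.2.val (colorPoint p v) =
        digitPolynomial p d w.2.val (colorPoint p v) := by
    intro v hv
    obtain ⟨w, hw, h⟩ := hst v hv
    obtain ⟨h1, h2, -, -, h3⟩ := paletteColor_eq h
    refine ⟨w, hw, h1, ?_, h3⟩
    rcases hM v hv with h | h <;> rcases hM' w hw with h' | h' <;> omega
  -- A vertex in the lower layer shows the polynomial of `M - 1`. By `digitPolynomial_succ` the
  -- correction to that of `M` depends only on which powers of `p` divide `M`, and a top vertex
  -- carries this in its color.
  have hval : ∀ v ∈ s,
      digitPolynomial p d M (colorPoint p v) = digitPolynomial p d M' (colorPoint p v) := by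
    intro v hv
    obtain ⟨w, -, -, ⟨h1, h2⟩ | ⟨h1, h2⟩, h3⟩ := hlayer v hv
    · rwa [h1, h2] at h3
    · rw [← h1, ← h2, digitPolynomial_succ, digitPolynomial_succ, h3, h1, h2]
      simp_rw [hdvd]
  -- The difference of the two polynomials has `d` coefficients and vanishes at `d` distinct points,
  -- so it is zero by Vandermonde; the digits agree, and `n < p ^ d` makes them determine the layer.
  have hMM : M = M' := by
    refine eq_of_digits_eq (p := p) d (by omega) (by omega) fun k hk => ?_
    let q := (s.equivFinOfCardEq hsd).symm
    have hinj : Function.Injective fun i => colorPoint p (q i).1 := fun i j hij =>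
      q.injective (Subtype.ext (colorPoint_injOn hp hs (q i).2 (q j).2 hij))
    have hzero := Matrix.eq_zero_of_forall_index_sum_pow_mul_eq_zero
      (v := fun k : Fin d => ((M / p ^ (k : ℕ) : ℕ) : ZMod p) - ((M' / p ^ (k : ℕ) : ℕ) : ZMod p))
      hinj fun i => by
        have := hval (q i).1 (q i).2
        simp only [mul_sub, Finset.sum_sub_distrib]
        exact sub_eq_zero.2 this
    exact sub_eq_zero.1 (congrFun hzero ⟨k, hk⟩)
  refine Finset.eq_of_subset_of_card_le (fun v hv => ?_) (by omega)
  obtain ⟨w, hw, h1, h2, -⟩ := hlayer v hv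
  have : v = w := Prod.ext h1 (Fin.ext (by omega))
  exact this ▸ hw

/-- The coloring of the stacked complex by natural numbers. -/
noncomputable def stackedColoring (p : ℕ) [NeZero p] (v : Fin (d + 1) × Fin (n + 1)) : ℕ :=
  Fintype.equivFin (Palette d p) (paletteColor p v)

theorem stackedColoring_eq_iff [NeZero p] {v w : Fin (d + 1) × Fin (n + 1)} :
    stackedColoring p v = stackedColoring p w ↔ paletteColor p v = paletteColor p w := by
  rw [stackedColoring, stackedColoring, ← Fin.ext_iff, Equiv.apply_eq_iff_eq]

theorem isProperColoring_stackedColoring [Fact p.Prime] (hp : 3 * (d + 1) ≤ p) (hn : n < p ^ d) :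
    IsProperColoring (stackedComplex d n) d (stackedColoring p) := by
  refine ⟨fun e he _ u hu v hv huv h => huv ?_, fun s hs t ht hsd htd hst h => hst ?_⟩
  · obtain ⟨h1, h2, -⟩ := paletteColor_eq (stackedColoring_eq_iff.1 h)
    exact eq_of_residues_eq he hu hv h1 h2
  · refine eq_of_paletteColor_subset hp hn hs ht hsd htd (fun v hv => ?_) fun w hw => ?_
    · obtain ⟨w, hw, hwv⟩ := Finset.mem_image.1 (h ▸ Finset.mem_image_of_mem (stackedColoring p) hv)
      exact ⟨w, hw, (stackedColoring_eq_iff.1 hwv).symm⟩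
    · obtain ⟨v, hv, hvw⟩ := Finset.mem_image.1 (h.symm ▸ Finset.mem_image_of_mem (stackedColoring p) hw)
      exact ⟨v, hv, stackedColoring_eq_iff.1 hvw⟩

theorem numSimplices_zero_stackedColoring_le [NeZero p] :
    numSimplices (patternComplex (stackedComplex d n) (stackedColoring p)) 0 ≤
      (d + 1) * (3 * (2 ^ d * p)) := by
  have hcard : Fintype.card (Palette d p) = (d + 1) * (3 * (2 ^ d * p)) := by
    simp [Palette, ZMod.card]
  set N := Fintype.card (Palette d p) with hN
  have hle : Nat.card (Simplex (patternComplex (stackedComplex d n) (stackedColoring p)) 0) ≤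
      Nat.card (Finset.powersetCard 1 (Finset.range N)) := by
    refine Nat.card_le_card_of_injective (fun s => ⟨s.1, Finset.mem_powersetCard.2 ⟨?_, s.2.2⟩⟩)
      fun s t h => Subtype.ext (Subtype.mk.inj h)
    obtain ⟨_, ⟨t, -, rfl⟩, -⟩ := s
    intro x hx
    obtain ⟨v, -, rfl⟩ := Finset.mem_image.1 hx
    exact Finset.mem_range.2 (Fin.isLt _)
  rw [numSimplices, ← hcard]
  refine hle.trans ?_
  rw [Nat.card_eq_fintype_card, Fintype.card_coe, Finset.card_powersetCard, Finset.card_range,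
    Nat.choose_one_right]

theorem le_numSimplices_stackedComplex : n ≤ numSimplices (stackedComplex d n) d := by
  let f : Fin n → Simplex (stackedComplex d n) d := fun m =>
    ⟨insert (0, m.castSucc) (layerFace 0 m.succ), stellarBottom_mem_stackedComplex m 0 fun v => by
      rw [Finset.mem_insert, mem_layerFace], by
      rw [Finset.card_insert_of_notMem fun h => (mem_layerFace.1 h).1 rfl, card_layerFace]⟩
  have hf : Function.Injective f := by
    intro m m' h
    have h1 : ((0 : Fin (d + 1)), m.castSucc) ∈ (f m').1 := h ▸ Finset.mem_insert_self _ _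
    rcases Finset.mem_insert.1 h1 with h2 | h2
    · exact Fin.castSucc_injective _ (Prod.mk.inj h2).2
    · exact absurd rfl (mem_layerFace.1 h2).1
  simpa [numSimplices] using Nat.card_le_card_of_injective f hf

/-- A `d`-simplex is the bottom one or a subset of the `2 (d + 1)` vertices of one of the `n`
blocks; the extra one is absorbed using `1 ≤ n`. -/
theorem numSimplices_stackedComplex_le (hn : 1 ≤ n) :
    numSimplices (stackedComplex d n) d ≤ (2 ^ ((d + 1) * 2) + 1) * n := by
  have hex : ∀ s : Simplex (stackedComplex d n) d,
      ∃ o : Option (Fin n × Finset (Fin (d + 1) × Fin 2)),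
        ∀ v, v ∈ s.1 ↔ o.elim (v.2 = 0) fun q => ∃ x ∈ q.2, blockInclusion d q.1 x = v := by
    intro s
    rcases exists_of_mem_stackedComplex s.2.1 with h | ⟨m, t, -, -, hmem⟩
    · refine ⟨none, fun v => ?_⟩
      rw [Finset.eq_of_subset_of_card_le h (by simp [s.2.2]), Finset.mem_product,
        Finset.mem_singleton]
      exact and_iff_right (Finset.mem_univ _)
    · exact ⟨some (m, t), hmem⟩
  choose o ho using hex
  have hinj : Function.Injective o := by
    intro s t h
    refine Subtype.ext (Finset.ext fun v => ?_)
    rw [ho, ho, h]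
  have h := Nat.card_le_card_of_injective o hinj
  have hcard : Nat.card (Option (Fin n × Finset (Fin (d + 1) × Fin 2))) =
      n * 2 ^ ((d + 1) * 2) + 1 := by
    simp [Nat.card_eq_fintype_card]
  rw [hcard] at h
  rw [numSimplices]
  nlinarith

theorem hasDim_stackedComplex : HasDim (stackedComplex d n) d :=
  ⟨⟨Finset.univ ×ˢ {0}, Or.inl ⟨⟨(0, 0), by simp⟩, Finset.Subset.refl _⟩, by simp⟩,
    fun _ hs => card_le_of_mem_stackedComplex hs⟩

theorem HasDim.patternComplex {V : Type*} {K : PreAbstractSimplicialComplex V} {c : V → ℕ} {k : ℕ}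
    (hK : HasDim K d) (hc : IsProperColoring K k c) : HasDim (patternComplex K c) d := by
  obtain ⟨⟨s, hs, hcard⟩, hle⟩ := hK
  refine ⟨⟨_, image_mem_patternComplex hs, by rw [hc.card_image hs, hcard]⟩, ?_⟩
  rintro _ ⟨t, ht, rfl⟩
  exact Finset.card_image_le.trans (hle t ht)

/-- Take `r` least with `n < r ^ d`, and `p` from Bertrand's postulate above `3 (d + 1) r`.
Minimality gives `(r - 1) ^ d ≤ n`, and `r ≤ 2 (r - 1)`. -/
theorem exists_prime_pow_gt (hd : 1 ≤ d) (hn : 1 ≤ n) :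
    ∃ p : ℕ, p.Prime ∧ 3 * (d + 1) ≤ p ∧ n < p ^ d ∧ p ^ d ≤ (12 * (d + 1)) ^ d * n := by
  have hex : ∃ r, n < r ^ d := ⟨n + 1, (Nat.lt_succ_self n).trans_le
    (Nat.le_self_pow (by omega) (n + 1))⟩
  classical
  set r := Nat.find hex with hr
  have hspec : n < r ^ d := Nat.find_spec hex
  have hr2 : 2 ≤ r := by
    by_contra hlt
    have : r ^ d ≤ 1 ^ d := Nat.pow_le_pow_left (by omega) d
    rw [one_pow] at this
    omega
  have hmin : (r - 1) ^ d ≤ n := not_lt.1 (Nat.find_min hex (by omega))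
  obtain ⟨p, hp, h1, h2⟩ := Nat.exists_prime_lt_and_le_two_mul (3 * (d + 1) * r) (by positivity)
  have hrp : r ≤ p := by nlinarith
  refine ⟨p, hp, by nlinarith, hspec.trans_le (Nat.pow_le_pow_left hrp d), ?_⟩
  calc p ^ d ≤ (12 * (d + 1) * (r - 1)) ^ d := by
        refine Nat.pow_le_pow_left (h2.trans ?_) d
        calc 2 * (3 * (d + 1) * r) ≤ 2 * (3 * (d + 1) * (2 * (r - 1))) := by
              gcongr; omega
          _ = 12 * (d + 1) * (r - 1) := by ring
    _ = (12 * (d + 1)) ^ d * (r - 1) ^ d := mul_pow _ _ _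
    _ ≤ _ := Nat.mul_le_mul_left _ hmin

end Coloring

/-! ### Transfer to the pattern complex and the constants. -/

/-- The lexicographic order of the vertices, the layer first. -/
abbrev layerOrder (d n : ℕ) : LinearOrder (Fin (d + 1) × Fin (n + 1)) :=
  LinearOrder.lift' (fun v => toLex (v.2, v.1)) fun v w h => by
    have h' := Prod.mk.inj (toLex.injective h)
    exact Prod.ext h'.2 h'.1

section PatternEigenvalue

attribute [local instance] decidableEqOfLinearOrder

/-- The upper Laplacian of the pattern complex of a proper coloring of the stacked complex has an
exponentially small non-zero eigenvalue. -/
theorem exists_eigenvalue_upLaplacian_patternComplex {e n : ℕ} (hn : 1 ≤ n)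
    {col : Fin (e + 1 + 1) × Fin (n + 1) → ℕ}
    (hcol : IsProperColoring (stackedComplex (e + 1) n) (e + 1) col) :
    ∃ μ : ℝ, μ ≠ 0 ∧ Module.End.HasEigenvalue
      (Matrix.toLin' (upLaplacian (patternComplex (stackedComplex (e + 1) n) col) e)) μ ∧
      μ * ((e : ℝ) + 1) ^ (2 * n) ≤ e + 2 := by
  -- The conclusion involves only the order of the colors, so any order of the vertices may be
  -- chosen.
  let _ := layerOrder (e + 1) n
  obtain ⟨μ, h0, hev, hle⟩ := exists_eigenvalue_upLaplacian_stackedComplex (e := e) (n := n)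
    (fun m u v huv => by
      change toLex (m, u) < toLex (m, v)
      exact Prod.Lex.toLex_lt_toLex.2 (Or.inr ⟨rfl, huv⟩)) hn
  exact ⟨μ, h0, (hasEigenvalue_toLin'_iff_of_charpoly_eq
    (charpoly_upLaplacian_patternComplex hcol) μ).2 hev, hle⟩

end PatternEigenvalue

theorem choose_numSimplices_le {d n p : ℕ} [NeZero p] (hp : p ^ d ≤ (12 * (d + 1)) ^ d * n) :
    (numSimplices (patternComplex (stackedComplex d n) (stackedColoring p)) 0).choose d ≤
      ((d + 1) * (3 * 2 ^ d) * (12 * (d + 1))) ^ d * n :=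
  calc _ ≤ (numSimplices (patternComplex (stackedComplex d n) (stackedColoring p)) 0) ^ d :=
        Nat.choose_le_pow _ _
    _ ≤ ((d + 1) * (3 * (2 ^ d * p))) ^ d :=
        Nat.pow_le_pow_left numSimplices_zero_stackedColoring_le d
    _ = ((d + 1) * (3 * 2 ^ d)) ^ d * p ^ d := by rw [← mul_pow]; ring_nf
    _ ≤ ((d + 1) * (3 * 2 ^ d)) ^ d * ((12 * (d + 1)) ^ d * n) := Nat.mul_le_mul_left _ hp
    _ = _ := by rw [← mul_assoc, ← mul_pow]

/-- Passing from the number of layers to the number of simplices in the exponent. -/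
theorem le_two_div_rpow_pow {e n N M : ℕ} (hn : 1 ≤ n) (hM : M ≠ 0) (hN : N ≤ M * n) {μ : ℝ}
    (hμ : μ * ((e : ℝ) + 1) ^ (2 * n) ≤ e + 2) :
    μ ≤ 2 / (((e : ℝ) + 1) ^ ((M : ℝ)⁻¹)) ^ N := by
  have h1 : (1 : ℝ) ≤ (e : ℝ) + 1 := by linarith [(Nat.cast_nonneg e : (0 : ℝ) ≤ e)]
  have hc : (1 : ℝ) ≤ ((e : ℝ) + 1) ^ ((M : ℝ)⁻¹) := Real.one_le_rpow h1 (by positivity)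
  have hpow : (((e : ℝ) + 1) ^ ((M : ℝ)⁻¹)) ^ N ≤ ((e : ℝ) + 1) ^ n :=
    calc _ ≤ (((e : ℝ) + 1) ^ ((M : ℝ)⁻¹)) ^ (M * n) := pow_le_pow_right₀ hc hN
      _ = _ := by rw [pow_mul, Real.rpow_inv_natCast_pow (by linarith) hM]
  -- One factor `d ^ n` is spent on `d + 1 ≤ 2 d ^ n`, which makes the constant `2` independent of
  -- `d`.
  have hE : (e : ℝ) + 1 ≤ ((e : ℝ) + 1) ^ n := le_self_pow₀ h1 (by omega)
  have hEpos : (0 : ℝ) < ((e : ℝ) + 1) ^ n := by positivity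
  refine le_trans ?_ (div_le_div_of_nonneg_left zero_le_two (by positivity) hpow)
  rw [le_div_iff₀ hEpos]
  refine le_of_mul_le_mul_right ?_ hEpos
  calc μ * ((e : ℝ) + 1) ^ n * ((e : ℝ) + 1) ^ n = μ * ((e : ℝ) + 1) ^ (2 * n) := by
        rw [two_mul, pow_add]; ring
    _ ≤ e + 2 := hμ
    _ ≤ 2 * ((e : ℝ) + 1) ^ n := by linarith [(Nat.cast_nonneg e : (0 : ℝ) ≤ e)]

end SpectralGap

theorem mainTheorem4 :
    (∃ A : ℝ, 0 < A ∧ ∀ d : ℕ, 1 ≤ d →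
      ∃ c κ : ℝ, 1 ≤ c ∧ (2 ≤ d → 1 < c) ∧ 0 < κ ∧ ∀ n : ℕ, 1 ≤ n →
        ∃ col : Fin (d + 1) × Fin (n + 1) → ℕ,
          SpectralGap.IsProperColoring (SpectralGap.stackedComplex d n) d col ∧
          let C := SpectralGap.patternComplex (SpectralGap.stackedComplex d n) col
          SpectralGap.HasDim C d ∧
          κ * ((SpectralGap.numSimplices C 0).choose d : ℝ) ≤ SpectralGap.numSimplices C d ∧
          (∃ μ : ℝ, SpectralGap.IsSpectralGap (SpectralGap.laplacian C (d - 1)) μ ∧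
            μ ≤ A / c ^ SpectralGap.numSimplices C d) ∧
          (∃ μ : ℝ, SpectralGap.IsSpectralGap (SpectralGap.laplacian C d) μ ∧
            μ ≤ A / c ^ SpectralGap.numSimplices C d)) ∧
    (∀ (V : Type*) [LinearOrder V] (K : PreAbstractSimplicialComplex V) [Finite K.faces]
      (d : ℕ) (col : V → ℕ), 1 ≤ d → SpectralGap.HasDim K d →
        SpectralGap.IsProperColoring K d col →
        (SpectralGap.upLaplacian (SpectralGap.patternComplex K col) (d - 1)).charpoly =
          (SpectralGap.upLaplacian K (d - 1)).charpoly) := by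
  refine ⟨⟨2, two_pos, fun d hd => ?_⟩, fun V _ K _ d col hd _ hcol => ?_⟩
  · obtain ⟨e, rfl⟩ : ∃ e, d = e + 1 := ⟨d - 1, by omega⟩
    set W : ℕ := ((e + 1 + 1) * (3 * 2 ^ (e + 1)) * (12 * (e + 1 + 1))) ^ (e + 1) with hW
    have hWpos : (0 : ℝ) < W := by positivity
    set M : ℕ := 2 ^ ((e + 1 + 1) * 2) + 1 with hM
    -- The base is `d ^ (1/M)` with `n_d ≤ M n`, so that its `n_d`-th power is at most `d ^ n`; it
    -- exceeds `1` for `d ≥ 2`. The other constant is `1/W`, since `n_0.choose d ≤ W n ≤ W n_d`.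
    refine ⟨((e : ℝ) + 1) ^ ((M : ℝ)⁻¹), (W : ℝ)⁻¹, Real.one_le_rpow ?_ (by positivity),
      fun he => Real.one_lt_rpow ?_ (by positivity), inv_pos.2 hWpos, fun n hn => ?_⟩
    · linarith [(Nat.cast_nonneg e : (0 : ℝ) ≤ e)]
    · have : (1 : ℝ) ≤ e := by exact_mod_cast (by omega : 1 ≤ e)
      linarith
    · obtain ⟨p, hp, hp1, hp2, hp3⟩ := SpectralGap.exists_prime_pow_gt hd hn
      have : Fact p.Prime := ⟨hp⟩
      have hcol := SpectralGap.isProperColoring_stackedColoring hp1 hp2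
      refine ⟨SpectralGap.stackedColoring p, hcol, ?_⟩
      intro C
      have hdim : SpectralGap.HasDim C (e + 1) :=
        SpectralGap.hasDim_stackedComplex.patternComplex hcol
      have hnum : SpectralGap.numSimplices C (e + 1) =
          SpectralGap.numSimplices (SpectralGap.stackedComplex (e + 1) n) (e + 1) :=
        SpectralGap.numSimplices_patternComplex hcol
      have hupper : SpectralGap.numSimplices C (e + 1) ≤ M * n :=
        hnum ▸ SpectralGap.numSimplices_stackedComplex_le hn
      obtain ⟨μ, h0, hev, hle⟩ :=
        SpectralGap.exists_eigenvalue_upLaplacian_patternComplex hn hcol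
      have hbound := SpectralGap.le_two_div_rpow_pow hn (Nat.succ_ne_zero _) hupper hle
      obtain ⟨ν, hν, hνμ⟩ := SpectralGap.exists_isSpectralGap_le h0
        (SpectralGap.hasEigenvalue_laplacian_of_upLaplacian h0 hev)
      obtain ⟨ν', hν', hνμ'⟩ := SpectralGap.exists_isSpectralGap_le h0
        (SpectralGap.hasEigenvalue_laplacian_succ_of_upLaplacian hdim h0 hev)
      refine ⟨hdim, ?_, ⟨ν, hν, hνμ.trans hbound⟩, ⟨ν', hν', hνμ'.trans hbound⟩⟩
      rw [inv_mul_le_iff₀ hWpos, hnum]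
      have h1 := SpectralGap.choose_numSimplices_le hp3
      have h2 : n ≤ SpectralGap.numSimplices (SpectralGap.stackedComplex (e + 1) n) (e + 1) :=
        SpectralGap.le_numSimplices_stackedComplex
      exact_mod_cast h1.trans (Nat.mul_le_mul_left W h2)
  · obtain ⟨e, rfl⟩ : ∃ e, d = e + 1 := ⟨d - 1, by omega⟩
    exact SpectralGap.charpoly_upLaplacian_patternComplex hcol
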